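/- Let $K$ be a field of characteristic $0$, let $n\ge 2$, and let $f(x,y)=f_0x^n+f_1x^{n-1}y+\dots+f_ny^n\in K[x,y]$ be a binary form of nonzero discriminant with $f_0\neq 0$. For a symmetric $n\times n$ matrix $A$ put $\operatorname{disc}(A)=(-1)^{n(n-1)/2}\det A$. Let $V_f(K)$ be the set of pairs $(A,B)$ of symmetric $n\times n$ matrices over $K$ with $\operatorname{disc}(Ax-By)=f(x,y)$, on which $\mathrm{SL}_n(K)$ acts by $g\cdot(A,B)=(g^{-t}Ag^{-1},g^{-t}Bg^{-1})$. Let $S_f\subset\mathbb P^1_K$ be the zero scheme of $f$, $L_f=H^0(S_f,\mathcal O_{S_f})$ (so that $L_f=K[X]/(f(X,1))$ with $X=x/y$, since $f_0\ne0$), and $I_f=H^0(S_f,\mathcal O_{S_f}(n-3))$, a free $L_f$-module with basis $y^{n-3}$. For a linear form $a\in K[x,y]$ let $\mathrm{ev}_a:I_f\to K$ be the composite $$I_f\to H^1(\mathbb P^1_K,\mathcal O(-3))\xrightarrow{\ \times a\ }H^1(\mathbb P^1_K,\mathcal O(-2))\cong K,$$ where the first map is the connecting map of $0\to\mathcal O(-3)\xrightarrow{\times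 f}\mathcal O(n-3)\to\mathcal O_{S_f}(n-3)\to0$ and the last isomorphism sends the class of the Čech cocycle $(xy)^{-1}$ (for the cover $D^+(y),D^+(x)$, the boundary of a lift $(s_{D^+(y)},s_{D^+(x)})$ being $(s_{D^+(y)}-s_{D^+(x)})/f$) to $1$. An $f$-module is a triple $(M,\varphi,e)$, where $M$ is a free $L_f$-module of rank $1$, $\varphi:M\otimes_{L_f}M\to I_f$ is an isomorphism of $L_f$-modules, and $e\in\wedge^n_KM$ is nonzero, such that for every $K$-basis $b_1,\dots,b_n$ of $M$ with $b_1\wedge\dots\wedge b_n=e$ the matrices $A_x,A_y$ of the bilinear forms $\mathrm{ev}_x\circ\varphi$, $\mathrm{ev}_y\circ\varphi$ in this basis satisfy $\operatorname{disc}(xA_y-yA_x)=f(x,y)$. An isomorphism of $f$-modules is an $L_f$-linear isomorphism of the underlying modules compatible with the maps $\varphi$ and the elements $e$. Then the following three sets are in bijection: 1. the set of orbits $\mathrm{SL}_n(K)\backslash V_f(K)$; 2. the set of isomorphism classes of $f$-modules $(M,\varphi,e)$; 3. the set of equivalence classes of pairs $(\alpha,z)\in L_f^\times\times K^\times$ with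 $z^2\,\mathbf N_{L_f/K}(\alpha)=f_0^{n+1}$, where $(\alpha,z)$ and $(\alpha',z')$ are equivalent if there is $\beta\in L_f^\times$ with $\alpha'=\beta^2\alpha$ and $z'=\mathbf N_{L_f/K}(\beta)^{-1}z$. More precisely, there are a bijection from (2) to (1) and a bijection from (2) to (3), given as follows. The class of $(M,\varphi,e)$ is sent to the orbit of $(A_y,A_x)$, computed in any $K$-basis of $M$ with $b_1\wedge\dots\wedge b_n=e$; the pairs in this orbit are exactly the pairs $(A_y,A_x)$ for such bases. The class of $(M,\varphi,e)$ is sent to the class of the pair $(\alpha,z)$ determined by any generator $u$ of the $L_f$-module $M$ through $\varphi(u\otimes u)=\alpha y^{n-3}$ and $u^{-1}_*(e)=z\,(1\wedge X\wedge\dots\wedge X^{n-1})\in\wedge^n_KL_f$, where $u^{-1}_*$ is induced by the inverse of $L_f\to M$, $\lambda\mapsto\lambda u$; the pairs in this class are exactly the pairs obtained from generators of $M$. -/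

import Mathlib

universe u

noncomputable section

namespace PencilOrbits

open scoped Matrix Polynomial LaurentPolynomial TensorProduct

/-! ### Binary forms, pairs of symmetric matrices and their orbits

A binary form `f_0 x^n + f_1 x^{n-1} y + ⋯ + f_n y^n` over `R` is given by its vector of
coefficients `f : Fin (n + 1) → R`. -/

/-- The polynomial `f(x, y) = f_0 x^n + f_1 x^{n-1} y + ⋯ + f_n y^n`, where the variables `x`, `y`
are `X 0`, `X 1`. -/
def formPoly {R : Type*} [CommRing R] {n : ℕ} (f : Fin (n + 1) → R) : MvPolynomial (Fin 2) R :=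
  ∑ i : Fin (n + 1),
    MvPolynomial.C (f i) * MvPolynomial.X 0 ^ (n - (i : ℕ)) * MvPolynomial.X 1 ^ (i : ℕ)

/-- The discriminant of `f` is nonzero: over an algebraic closure one has
`f = ∏ i, (α_i x - β_i y)` and `∏_{i < j} (α_i β_j - α_j β_i)^2` is nonzero. -/
def DiscrNeZero {K : Type u} [Field K] {n : ℕ} (f : Fin (n + 1) → K) : Prop :=
  ∃ α β : Fin n → AlgebraicClosure K,
    MvPolynomial.map (algebraMap K (AlgebraicClosure K)) (formPoly f) =
      ∏ i, (MvPolynomial.C (α i) * MvPolynomial.X 0 - MvPolynomial.C (β i) * MvPolynomial.X 1) ∧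
    ∏ i, ∏ j ∈ Finset.Ioi i, (α i * β j - α j * β i) ^ 2 ≠ 0

/-- The discriminant `(-1)^{n(n-1)/2} det A` of a symmetric matrix. -/
def matDisc {R : Type*} [CommRing R] {n : ℕ} (A : Matrix (Fin n) (Fin n) R) : R :=
  (-1) ^ (n * (n - 1) / 2) * A.det

/-- The invariant binary form `disc (A x - B y)` of a pair of matrices. -/
def invariantForm {R : Type*} [CommRing R] {n : ℕ} (A B : Matrix (Fin n) (Fin n) R) :
    MvPolynomial (Fin 2) R :=
  matDisc ((MvPolynomial.X 0 : MvPolynomial (Fin 2) R) • A.map MvPolynomial.C -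
    (MvPolynomial.X 1 : MvPolynomial (Fin 2) R) • B.map MvPolynomial.C)

/-- The set `V_f(K)` of pairs `(A, B)` of symmetric `n × n` matrices over `K` whose invariant form
is `f`. -/
@[ext]
structure Vf {K : Type u} [Field K] {n : ℕ} (f : Fin (n + 1) → K) where
  A : Matrix (Fin n) (Fin n) K
  B : Matrix (Fin n) (Fin n) K
  symmA : A.IsSymm
  symmB : B.IsSymm
  form_eq : invariantForm A B = formPoly f

theorem isSymm_conj {K : Type u} [Field K] {n : ℕ} (h : Matrix (Fin n) (Fin n) K)
    {A : Matrix (Fin n) (Fin n) K} (hA : A.IsSymm) : (hᵀ * A * h).IsSymm := by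
  unfold Matrix.IsSymm at *
  rw [Matrix.transpose_mul, Matrix.transpose_mul, Matrix.transpose_transpose, hA, Matrix.mul_assoc]

theorem invariantForm_conj {K : Type u} [Field K] {n : ℕ} (h A B : Matrix (Fin n) (Fin n) K)
    (hdet : h.det = 1) : invariantForm (hᵀ * A * h) (hᵀ * B * h) = invariantForm A B := by
  unfold invariantForm matDisc
  set c : K →+* MvPolynomial (Fin 2) K := MvPolynomial.C with hc
  have key : (MvPolynomial.X 0 : MvPolynomial (Fin 2) K) • (hᵀ * A * h).map c -
      (MvPolynomial.X 1 : MvPolynomial (Fin 2) K) • (hᵀ * B * h).map c =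
      (h.map c)ᵀ * ((MvPolynomial.X 0 : MvPolynomial (Fin 2) K) • A.map c -
        (MvPolynomial.X 1 : MvPolynomial (Fin 2) K) • B.map c) * h.map c := by
    simp only [Matrix.map_mul, Matrix.mul_sub, Matrix.sub_mul, Matrix.transpose_map,
      Matrix.mul_smul, Matrix.smul_mul]
  have hd : (h.map c).det = 1 := by
    have := RingHom.map_det c h
    rw [hdet, map_one] at this
    exact this.symm
  rw [key, Matrix.det_mul, Matrix.det_mul, Matrix.det_transpose, hd]
  ring

/-- The action `g • (A, B) = (g^{-t} A g^{-1}, g^{-t} B g^{-1})` of `SL_n(K)` on `V_f(K)`. -/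
instance Vf.mulAction {K : Type u} [Field K] {n : ℕ} (f : Fin (n + 1) → K) :
    MulAction (Matrix.SpecialLinearGroup (Fin n) K) (Vf f) where
  smul g v :=
    { A := (g⁻¹).1ᵀ * v.A * (g⁻¹).1
      B := (g⁻¹).1ᵀ * v.B * (g⁻¹).1
      symmA := isSymm_conj _ v.symmA
      symmB := isSymm_conj _ v.symmB
      form_eq := (invariantForm_conj _ _ _ (g⁻¹).2).trans v.form_eq }
  one_smul v := by
    apply Vf.ext
    · change ((1 : Matrix.SpecialLinearGroup (Fin n) K)⁻¹).1ᵀ * v.A *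
        ((1 : Matrix.SpecialLinearGroup (Fin n) K)⁻¹).1 = v.A
      rw [inv_one]
      change (1 : Matrix (Fin n) (Fin n) K)ᵀ * v.A * 1 = v.A
      simp
    · change ((1 : Matrix.SpecialLinearGroup (Fin n) K)⁻¹).1ᵀ * v.B *
        ((1 : Matrix.SpecialLinearGroup (Fin n) K)⁻¹).1 = v.B
      rw [inv_one]
      change (1 : Matrix (Fin n) (Fin n) K)ᵀ * v.B * 1 = v.B
      simp
  mul_smul g h v := by
    apply Vf.ext
    · change ((g * h)⁻¹).1ᵀ * v.A * ((g * h)⁻¹).1 =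
        (g⁻¹).1ᵀ * ((h⁻¹).1ᵀ * v.A * (h⁻¹).1) * (g⁻¹).1
      rw [mul_inv_rev]
      change ((h⁻¹).1 * (g⁻¹).1)ᵀ * v.A * ((h⁻¹).1 * (g⁻¹).1) = _
      simp only [Matrix.transpose_mul, Matrix.mul_assoc]
    · change ((g * h)⁻¹).1ᵀ * v.B * ((g * h)⁻¹).1 =
        (g⁻¹).1ᵀ * ((h⁻¹).1ᵀ * v.B * (h⁻¹).1) * (g⁻¹).1
      rw [mul_inv_rev]
      change ((h⁻¹).1 * (g⁻¹).1)ᵀ * v.B * ((h⁻¹).1 * (g⁻¹).1) = _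
      simp only [Matrix.transpose_mul, Matrix.mul_assoc]

/-- The set of orbits `SL_n(K) \ V_f(K)`. -/
abbrev Orbits {K : Type u} [Field K] {n : ℕ} (f : Fin (n + 1) → K) : Type u :=
  MulAction.orbitRel.Quotient (Matrix.SpecialLinearGroup (Fin n) K) (Vf f)

/-! ### Sections over the zero scheme `S_f ⊂ ℙ¹`

The projective line is covered by the charts `D⁺(y)` with coordinate `x / y`, and `D⁺(x)` with
coordinate `y / x`. On the overlap we use the coordinate `t = x / y`.
The sheaf `𝒪(k)` is trivialised by `y ^ k` on `D⁺(y)` and on the overlap, and by `x ^ k` on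
`D⁺(x)`; on the overlap, `x ^ k = t ^ k y ^ k`. -/

section Charts

variable {K : Type u} [Field K] {n : ℕ} (f : Fin (n + 1) → K)

/-- The equation `f(X, 1)` of `S_f` in `D⁺(y)`. -/
def dehomY : K[X] := ∑ i : Fin (n + 1), Polynomial.C (f i) * Polynomial.X ^ (n - (i : ℕ))

/-- The equation `f(1, X)` of `S_f` in `D⁺(x)`. -/
def dehomX : K[X] := ∑ i : Fin (n + 1), Polynomial.C (f i) * Polynomial.X ^ (i : ℕ)

/-- The equation `f(t, 1)` of `S_f` in the overlap of the two charts. -/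
def dehomXY : K[T;T⁻¹] := Polynomial.toLaurent (dehomY f)

/-- Functions on `S_f ∩ D⁺(y)`. -/
abbrev ChartY : Type u := AdjoinRoot (dehomY f)

/-- Functions on `S_f ∩ D⁺(x)`. -/
abbrev ChartX : Type u := AdjoinRoot (dehomX f)

/-- Functions on `S_f ∩ D⁺(xy)`. -/
abbrev Overlap : Type u := K[T;T⁻¹] ⧸ Ideal.span {dehomXY f}

/-- The class of `t ^ k` on the overlap. -/
def tPow (k : ℤ) : Overlap f := Ideal.Quotient.mk _ (LaurentPolynomial.T k)

theorem tPow_add (k l : ℤ) : tPow f (k + l) = tPow f k * tPow f l := by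
  simp only [tPow, LaurentPolynomial.T_add, map_mul]

theorem tPow_zero : tPow f 0 = 1 := by
  simp only [tPow, LaurentPolynomial.T_zero, map_one]

theorem dehomXY_eq : dehomXY f =
    LaurentPolynomial.T (n : ℤ) * LaurentPolynomial.invert (Polynomial.toLaurent (dehomX f)) := by
  simp only [dehomXY, dehomY, dehomX, map_sum, map_mul, Polynomial.toLaurent_C,
    Polynomial.toLaurent_X_pow, LaurentPolynomial.invert_C, LaurentPolynomial.invert_T,
    Finset.mul_sum]
  refine Finset.sum_congr rfl fun i _ => ?_
  rw [mul_left_comm, ← LaurentPolynomial.T_add]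
  congr 2
  have := i.2
  omega

theorem eval_tPow_one (p : K[X]) :
    p.eval₂ (Algebra.ofId K (Overlap f) : K →+* Overlap f) (tPow f 1) =
      Ideal.Quotient.mk _ (Polynomial.toLaurent p) := by
  induction p using Polynomial.induction_on' with
  | add p q hp hq => rw [Polynomial.eval₂_add, hp, hq, map_add, map_add]
  | monomial m a =>
    rw [Polynomial.eval₂_monomial, Polynomial.toLaurent_C_mul_T, map_mul, tPow, ← map_pow,
      LaurentPolynomial.T_pow, mul_one]
    rfl

theorem eval_tPow_neg_one (p : K[X]) :
    p.eval₂ (Algebra.ofId K (Overlap f) : K →+* Overlap f) (tPow f (-1)) =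
      Ideal.Quotient.mk _ (LaurentPolynomial.invert (Polynomial.toLaurent p)) := by
  induction p using Polynomial.induction_on' with
  | add p q hp hq => rw [Polynomial.eval₂_add, hp, hq, map_add, map_add, map_add]
  | monomial m a =>
    rw [Polynomial.eval₂_monomial, Polynomial.toLaurent_C_mul_T, map_mul, map_mul, tPow, ← map_pow,
      LaurentPolynomial.T_pow, LaurentPolynomial.invert_C, LaurentPolynomial.invert_T, mul_neg_one]
    rfl

/-- Restriction of functions from `S_f ∩ D⁺(y)` to the overlap: `x / y ↦ t`. -/
def resY : ChartY f →ₐ[K] Overlap f :=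
  AdjoinRoot.liftAlgHom (dehomY f) (Algebra.ofId K (Overlap f)) (tPow f 1) (by
    rw [eval_tPow_one, Ideal.Quotient.eq_zero_iff_mem]
    exact Ideal.mem_span_singleton_self _)

/-- Restriction of functions from `S_f ∩ D⁺(x)` to the overlap: `y / x ↦ t⁻¹`. -/
def resX : ChartX f →ₐ[K] Overlap f :=
  AdjoinRoot.liftAlgHom (dehomX f) (Algebra.ofId K (Overlap f)) (tPow f (-1)) (by
    rw [eval_tPow_neg_one, Ideal.Quotient.eq_zero_iff_mem, Ideal.mem_span_singleton, dehomXY_eq]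
    refine ⟨LaurentPolynomial.T (-(n : ℤ)), ?_⟩
    rw [mul_right_comm, ← LaurentPolynomial.T_add, add_neg_cancel, LaurentPolynomial.T_zero,
      one_mul])

theorem resY_mk (p : K[X]) :
    resY f (AdjoinRoot.mk _ p) = Ideal.Quotient.mk _ (Polynomial.toLaurent p) := by
  rw [resY, AdjoinRoot.liftAlgHom_mk]
  exact eval_tPow_one f p

theorem resX_mk (p : K[X]) :
    resX f (AdjoinRoot.mk _ p) =
      Ideal.Quotient.mk _ (LaurentPolynomial.invert (Polynomial.toLaurent p)) := by
  rw [resX, AdjoinRoot.liftAlgHom_mk]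
  exact eval_tPow_neg_one f p

/-- The `K`-algebra `L_f = H⁰(S_f, 𝒪)`: pairs of functions on the two charts of `S_f` that agree
on the overlap. -/
def Lf : Subalgebra K (ChartY f × ChartX f) :=
  AlgHom.equalizer ((resY f).comp (AlgHom.fst K (ChartY f) (ChartX f)))
    ((resX f).comp (AlgHom.snd K (ChartY f) (ChartX f)))

theorem mem_Lf (s : ChartY f × ChartX f) : s ∈ Lf f ↔ resY f s.1 = resX f s.2 := Iff.rfl

/-- The `L_f`-module `H⁰(S_f, 𝒪(k))`. The pair `(p, q)` stands for the section which is equal to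
`p y ^ k` on `D⁺(y)` and to `q x ^ k` on `D⁺(x)`. -/
def H0 (k : ℤ) : Submodule (Lf f) (ChartY f × ChartX f) where
  carrier := {s | resY f s.1 = tPow f k * resX f s.2}
  add_mem' {s s'} hs hs' := by
    simp only [Set.mem_ofPred_eq, Prod.fst_add, Prod.snd_add, map_add, mul_add] at *
    rw [hs, hs']
  zero_mem' := by simp
  smul_mem' l s hs := by
    have hl : resY f l.1.1 = resX f l.1.2 := l.2
    change resY f (l.1.1 * s.1) = tPow f k * resX f (l.1.2 * s.2)
    have hs' : resY f s.1 = tPow f k * resX f s.2 := hs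
    rw [map_mul, map_mul, hl, hs']
    ring

theorem mem_H0 (k : ℤ) (s : ChartY f × ChartX f) :
    s ∈ H0 f k ↔ resY f s.1 = tPow f k * resX f s.2 := Iff.rfl

instance (k : ℤ) : Module (Lf f) (H0 f k) := (H0 f k).module

instance (k : ℤ) : SMul (Lf f) (H0 f k) := (H0 f k).smul

/-- The `L_f`-module `I_f = H⁰(S_f, 𝒪(n - 3))`. -/
abbrev If : Submodule (Lf f) (ChartY f × ChartX f) := H0 f ((n : ℤ) - 3)

/-- For a section `s` of `𝒪(k)` on `S_f`, the Čech cocycle `h y ^ (k - n)` on the overlap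
represents the image of `s` under the connecting map `H⁰(S_f, 𝒪(k)) → H¹(ℙ¹, 𝒪(k - n))` of
`0 → 𝒪(k - n) → 𝒪(k) → 𝒪_{S_f}(k) → 0`, where the first map is multiplication by `f`: one lifts `s`
to sections `P y ^ k` of `𝒪(k)` on `D⁺(y)` and `Q x ^ k` on `D⁺(x)`, and divides the difference of
these lifts by `f`. -/
def IsBoundary (k : ℤ) (s : H0 f k) (h : K[T;T⁻¹]) : Prop :=
  ∃ P Q : K[X], AdjoinRoot.mk (dehomY f) P = s.1.1 ∧ AdjoinRoot.mk (dehomX f) Q = s.1.2 ∧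
    Polynomial.toLaurent P -
        LaurentPolynomial.T k * LaurentPolynomial.invert (Polynomial.toLaurent Q) =
      dehomXY f * h

theorem exists_isBoundary (k : ℤ) (s : H0 f k) : ∃ h, IsBoundary f k s h := by
  obtain ⟨P, hP⟩ := AdjoinRoot.mk_surjective s.1.1
  obtain ⟨Q, hQ⟩ := AdjoinRoot.mk_surjective s.1.2
  have hs := (mem_H0 f k s.1).1 s.2
  rw [← hP, ← hQ, resY_mk, resX_mk, tPow, ← map_mul, Ideal.Quotient.eq,
    Ideal.mem_span_singleton] at hs
  obtain ⟨h, hh⟩ := hs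
  exact ⟨h, P, Q, hP, hQ, hh⟩

/-- For the linear form `a = r x + s y`, the map `ev_a : I_f → H¹(ℙ¹, 𝒪(-3)) → H¹(ℙ¹, 𝒪(-2)) = K`
given by the connecting map, multiplication by `a`, and the isomorphism sending the class of the
cocycle `(xy)⁻¹ = t⁻¹ y⁻²` to `1` (so it reads off the coefficient of `t⁻¹`).
The value does not depend on the chosen cocycle by `ev_eq` below. -/
def ev (r s : K) (v : If f) : K :=
  ((LaurentPolynomial.C r * LaurentPolynomial.T 1 + LaurentPolynomial.C s) *
    (exists_isBoundary f _ v).choose).coeff (-1)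

variable {f}

theorem dehomXY_ne_zero (hf : f ≠ 0) : dehomXY f ≠ 0 := by
  obtain ⟨i, hi⟩ := Function.ne_iff.1 hf
  rw [dehomXY, Ne, Polynomial.toLaurent_eq_zero]
  intro h
  apply hi
  have h2 := congrArg (fun p => Polynomial.coeff p (n - (i : ℕ))) h
  simp only [dehomY, Polynomial.finsetSum_coeff, Polynomial.coeff_C_mul, Polynomial.coeff_X_pow,
    Polynomial.coeff_zero] at h2
  rw [Finset.sum_eq_single i] at h2
  · simpa using h2
  · intro j _ hj
    have : n - (i : ℕ) ≠ n - (j : ℕ) := by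
      intro h3
      apply hj
      ext
      have := i.2
      have := j.2
      omega
    simp [this]
  · simp

theorem coeff_C_mul_T (a : K) (k m : ℤ) :
    (LaurentPolynomial.C a * LaurentPolynomial.T k).coeff m = if k = m then a else 0 := by
  rw [← LaurentPolynomial.single_eq_C_mul_T]
  exact Finsupp.single_apply

theorem coeff_toLaurent_of_neg (p : K[X]) {m : ℤ} (hm : m < 0) :
    (Polynomial.toLaurent p).coeff m = 0 := by
  induction p using Polynomial.induction_on' with
  | add p q hp hq => rw [map_add, AddMonoidAlgebra.coeff_add, Finsupp.add_apply, hp, hq, add_zero]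
  | monomial k a =>
    rw [Polynomial.toLaurent_C_mul_T, coeff_C_mul_T, if_neg]
    omega

/-- Two cocycles representing the boundary of the same section differ by a coboundary. -/
theorem isBoundary_unique (hf : f ≠ 0) {k : ℤ} {s : H0 f k} {h h' : K[T;T⁻¹]}
    (hh : IsBoundary f k s h) (hh' : IsBoundary f k s h') :
    ∃ G G' : K[X], h - h' = Polynomial.toLaurent G -
      LaurentPolynomial.T (k - n) * LaurentPolynomial.invert (Polynomial.toLaurent G') := by
  obtain ⟨P, Q, hP, hQ, e⟩ := hh
  obtain ⟨P', Q', hP', hQ', e'⟩ := hh'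
  obtain ⟨G, hG⟩ := AdjoinRoot.mk_eq_mk.1 (hP.trans hP'.symm)
  obtain ⟨G', hG'⟩ := AdjoinRoot.mk_eq_mk.1 (hQ.trans hQ'.symm)
  refine ⟨G, G', mul_left_cancel₀ (dehomXY_ne_zero hf) ?_⟩
  have h1 : Polynomial.toLaurent P - Polynomial.toLaurent P' =
      dehomXY f * Polynomial.toLaurent G := by
    rw [← map_sub, hG, map_mul, dehomXY]
  have h2 : LaurentPolynomial.invert (Polynomial.toLaurent Q) -
      LaurentPolynomial.invert (Polynomial.toLaurent Q') =
      LaurentPolynomial.invert (Polynomial.toLaurent (dehomX f)) *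
        LaurentPolynomial.invert (Polynomial.toLaurent G') := by
    rw [← map_sub, ← map_sub, hG', map_mul, map_mul]
  have h3 : LaurentPolynomial.T k *
      LaurentPolynomial.invert (Polynomial.toLaurent (dehomX f)) =
      dehomXY f * LaurentPolynomial.T (k - n) := by
    rw [dehomXY_eq, mul_right_comm, ← LaurentPolynomial.T_add]
    congr 2
    ring
  calc dehomXY f * (h - h') = (Polynomial.toLaurent P - Polynomial.toLaurent P') -
        LaurentPolynomial.T k * (LaurentPolynomial.invert (Polynomial.toLaurent Q) -
          LaurentPolynomial.invert (Polynomial.toLaurent Q')) := by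
        rw [mul_sub, ← e, ← e']; ring
    _ = _ := by rw [h1, h2, ← mul_assoc, h3]; ring

theorem coeff_T_mul (m k : ℤ) (h : K[T;T⁻¹]) :
    (LaurentPolynomial.T m * h).coeff k = h.coeff (k - m) := by
  rw [LaurentPolynomial.T, AddMonoidAlgebra.coeff_single_mul_apply, one_mul]
  congr 1
  ring

theorem coeff_linear_mul (r s : K) (h : K[T;T⁻¹]) (k : ℤ) :
    ((LaurentPolynomial.C r * LaurentPolynomial.T 1 + LaurentPolynomial.C s) * h).coeff k =
      r * h.coeff (k - 1) + s * h.coeff k := by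
  have hC : ∀ (a : K) (g : K[T;T⁻¹]), (LaurentPolynomial.C a * g).coeff k = a * g.coeff k := by
    intro a g
    rw [← LaurentPolynomial.single_eq_C, AddMonoidAlgebra.coeff_single_mul_apply, neg_zero,
      zero_add]
  rw [add_mul, AddMonoidAlgebra.coeff_add, Finsupp.add_apply, mul_assoc, hC, hC, coeff_T_mul]

theorem coeff_coboundary (G G' : K[X]) {k m : ℤ} (hm : m < 0) (hk : k < m) :
    (Polynomial.toLaurent G -
      LaurentPolynomial.T k * LaurentPolynomial.invert (Polynomial.toLaurent G')).coeff m = 0 := by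
  rw [AddMonoidAlgebra.coeff_sub, Finsupp.sub_apply, coeff_T_mul, LaurentPolynomial.invert_apply,
    coeff_toLaurent_of_neg _ hm, coeff_toLaurent_of_neg _ (by omega), sub_zero]

/-- The value `ev_a(v)` may be computed with any cocycle representing the boundary of `v`. -/
theorem ev_eq (hf : f ≠ 0) (r s : K) (v : If f) {h : K[T;T⁻¹]} (hh : IsBoundary f _ v h) :
    ev f r s v =
      ((LaurentPolynomial.C r * LaurentPolynomial.T 1 + LaurentPolynomial.C s) * h).coeff (-1) := by
  obtain ⟨G, G', e⟩ := isBoundary_unique hf (exists_isBoundary f _ v).choose_spec hh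
  have e' : ∀ m : ℤ, m < 0 → -3 < m →
      (exists_isBoundary f _ v).choose.coeff m = h.coeff m := by
    intro m hm hm3
    rw [← sub_eq_zero, ← Finsupp.sub_apply, ← AddMonoidAlgebra.coeff_sub, e]
    exact coeff_coboundary G G' hm (by omega)
  rw [ev, coeff_linear_mul, coeff_linear_mul, e' _ (by norm_num) (by norm_num),
    e' _ (by norm_num) (by norm_num)]

/-- If `f_0 ≠ 0`, then `y / x` is invertible on `S_f ∩ D⁺(x)`. -/
theorem isUnit_root_dehomX (hf0 : f 0 ≠ 0) : IsUnit (AdjoinRoot.root (dehomX f)) := by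
  have h : dehomX f = Polynomial.X * (dehomX f).divX + Polynomial.C (f 0) := by
    conv_lhs => rw [← Polynomial.X_mul_divX_add (dehomX f)]
    congr 2
    simp only [dehomX, Polynomial.finsetSum_coeff, Polynomial.coeff_C_mul, Polynomial.coeff_X_pow]
    rw [Finset.sum_eq_single 0]
    · simp
    · intro j _ hj
      have : 0 ≠ (j : ℕ) := fun h => hj (Fin.ext h.symm)
      simp [this]
    · simp
  have h2 : AdjoinRoot.root (dehomX f) * AdjoinRoot.mk (dehomX f) (dehomX f).divX =
      - AdjoinRoot.of (dehomX f) (f 0) := by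
    rw [eq_neg_iff_add_eq_zero, ← AdjoinRoot.mk_X, ← AdjoinRoot.mk_C, ← map_mul, ← map_add, ← h,
      AdjoinRoot.mk_self]
  have h3 : IsUnit (- AdjoinRoot.of (dehomX f) (f 0)) :=
    ((IsUnit.mk0 _ hf0).map (AdjoinRoot.of (dehomX f))).neg
  exact isUnit_of_mul_isUnit_left (h2 ▸ h3)

theorem resX_unit_zpow (hf0 : f 0 ≠ 0) (k : ℤ) :
    tPow f k * resX f ((isUnit_root_dehomX hf0).unit ^ k : (ChartX f)ˣ) = 1 := by
  let t : (Overlap f)ˣ := ⟨tPow f 1, tPow f (-1), by rw [← tPow_add]; exact tPow_zero f,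
    by rw [← tPow_add]; exact tPow_zero f⟩
  have h1 : Units.map (resX f : ChartX f →* Overlap f) (isUnit_root_dehomX hf0).unit = t⁻¹ := by
    ext
    change resX f (AdjoinRoot.root (dehomX f)) = tPow f (-1)
    exact AdjoinRoot.liftAlgHom_root _ _ _ _
  have h2 : ∀ m : ℤ, ((t ^ m : (Overlap f)ˣ) : Overlap f) = tPow f m := by
    intro m
    induction m using Int.induction_on with
    | zero => rw [zpow_zero, tPow_zero]; rfl
    | succ m ih => rw [zpow_add_one, Units.val_mul, ih, tPow_add]
    | pred m ih =>
      rw [zpow_sub_one, Units.val_mul, ih, sub_eq_add_neg, tPow_add]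
      rfl
  have h3 : resX f ((isUnit_root_dehomX hf0).unit ^ k : (ChartX f)ˣ) =
      ((t⁻¹ ^ k : (Overlap f)ˣ) : Overlap f) := by
    rw [← h1, ← map_zpow]
    rfl
  rw [h3, ← h2, ← Units.val_mul, inv_zpow, mul_inv_cancel, Units.val_one]

/-- If `f_0 ≠ 0`: the function `X = x / y` on `S_f`. -/
def xOverY (hf0 : f 0 ≠ 0) : Lf f :=
  ⟨(AdjoinRoot.root (dehomY f), ((isUnit_root_dehomX hf0).unit⁻¹ : (ChartX f)ˣ)), by
    have h := resX_unit_zpow hf0 (-1)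
    rw [mem_Lf]
    have h1 : resY f (AdjoinRoot.root (dehomY f)) = tPow f 1 := AdjoinRoot.liftAlgHom_root _ _ _ _
    have h2 : tPow f 1 * tPow f (-1) = 1 := by
      rw [← tPow_add]; exact tPow_zero f
    rw [zpow_neg_one] at h
    dsimp only
    rw [h1, ← mul_one (tPow f 1), ← h, ← mul_assoc, h2, one_mul]⟩

/-- If `f_0 ≠ 0`: the section `y ^ k` of `𝒪(k)` on `S_f`; in terms of the trivialisations it is
`1 · y ^ k` on `D⁺(y)` and `(y / x) ^ k · x ^ k` on `D⁺(x)`. -/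
def yPow (hf0 : f 0 ≠ 0) (k : ℤ) : H0 f k :=
  ⟨(1, ((isUnit_root_dehomX hf0).unit ^ k : (ChartX f)ˣ)), by
    rw [mem_H0]
    dsimp only
    rw [resX_unit_zpow hf0, map_one]⟩

/-- If `f_0 ≠ 0`: the element `1 ∧ X ∧ ⋯ ∧ X^{n-1}` of `⋀ⁿ L_f`, where `X = x / y`. -/
def powerWedge (hf0 : f 0 ≠ 0) : ⋀[K]^n (Lf f) :=
  exteriorPower.ιMulti K n fun i : Fin n => xOverY hf0 ^ (i : ℕ)

end Charts

/-! ### `f`-modules -/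

section Modules

variable {K : Type u} [Field K] {n : ℕ}

/-- The matrix of the `K`-bilinear form `ev_a ∘ φ` with respect to the basis `b`, where
`a = r x + s y`. -/
def gram (f : Fin (n + 1) → K) {M : Type u} [AddCommGroup M] [Module (Lf f) M] [Module K M]
    (φ : M ⊗[Lf f] M ≃ₗ[Lf f] If f) (b : Module.Basis (Fin n) K M) (r s : K) :
    Matrix (Fin n) (Fin n) K :=
  Matrix.of fun i j => ev f r s (φ (b i ⊗ₜ[Lf f] b j))

/-- An `f`-module `(M, φ, e)`. The `K`-module structure on `M` is the one induced by its
`L_f`-module structure, by `isScalarTower`. In `disc_eq`, the two matrices are those of `ev_y ∘ φ`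
and of `ev_x ∘ φ`. -/
structure FModule (f : Fin (n + 1) → K) where
  M : Type u
  [addCommGroup : AddCommGroup M]
  [moduleL : Module (Lf f) M]
  [moduleK : Module K M]
  [isScalarTower : IsScalarTower K (Lf f) M]
  free : Module.Free (Lf f) M
  finrank_eq : Module.finrank (Lf f) M = 1
  φ : M ⊗[Lf f] M ≃ₗ[Lf f] If f
  e : ⋀[K]^n M
  e_ne_zero : e ≠ 0
  disc_eq : ∀ b : Module.Basis (Fin n) K M, exteriorPower.ιMulti K n b = e →
    invariantForm (gram f φ b 0 1) (gram f φ b 1 0) = formPoly f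

attribute [instance] FModule.addCommGroup FModule.moduleL FModule.moduleK FModule.isScalarTower

/-- The `K`-linear map on top exterior powers induced by an `L_f`-linear map. -/
def wedgeMap (f : Fin (n + 1) → K) {M N : Type u} [AddCommGroup M] [Module (Lf f) M] [Module K M]
    [IsScalarTower K (Lf f) M] [AddCommGroup N] [Module (Lf f) N] [Module K N]
    [IsScalarTower K (Lf f) N] (g : M →ₗ[Lf f] N) : ⋀[K]^n M →ₗ[K] ⋀[K]^n N :=
  exteriorPower.map n (g.restrictScalars K)

theorem wedgeMap_wedgeMap (f : Fin (n + 1) → K) {M N P : Type u}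
    [AddCommGroup M] [Module (Lf f) M] [Module K M] [IsScalarTower K (Lf f) M]
    [AddCommGroup N] [Module (Lf f) N] [Module K N] [IsScalarTower K (Lf f) N]
    [AddCommGroup P] [Module (Lf f) P] [Module K P] [IsScalarTower K (Lf f) P]
    (g : M →ₗ[Lf f] N) (g' : N →ₗ[Lf f] P) (e : ⋀[K]^n M) :
    wedgeMap f g' (wedgeMap f g e) = wedgeMap f (g' ∘ₗ g) e :=
  DFunLike.congr_fun
    (exteriorPower.map_comp (n := n) (g.restrictScalars K) (g'.restrictScalars K)).symm e

/-- Isomorphism of `f`-modules: an `L_f`-linear isomorphism intertwining `φ` and `e`. -/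
def FModule.Isomorphic {f : Fin (n + 1) → K} (S S' : FModule f) : Prop :=
  ∃ g : S.M ≃ₗ[Lf f] S'.M,
    (∀ a b : S.M, S'.φ (g a ⊗ₜ[Lf f] g b) = S.φ (a ⊗ₜ[Lf f] b)) ∧
    wedgeMap f g.toLinearMap S.e = S'.e

instance FModule.setoid (f : Fin (n + 1) → K) : Setoid (FModule f) where
  r := FModule.Isomorphic
  iseqv := by
    refine ⟨fun S => ⟨LinearEquiv.refl _ _, fun _ _ => rfl, ?_⟩, ?_, ?_⟩
    · exact DFunLike.congr_fun (exteriorPower.map_id (R := K) (M := S.M) (n := n)) S.e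
    · rintro S S' ⟨g, h1, h2⟩
      refine ⟨g.symm, fun a b => ?_, ?_⟩
      · rw [← h1, g.apply_symm_apply, g.apply_symm_apply]
      · rw [← h2, wedgeMap_wedgeMap]
        have : g.symm.toLinearMap ∘ₗ g.toLinearMap = LinearMap.id := by ext; simp
        rw [this]
        exact DFunLike.congr_fun (exteriorPower.map_id (R := K) (M := S.M) (n := n)) S.e
    · rintro S S' S'' ⟨g, h1, h2⟩ ⟨g', h1', h2'⟩
      refine ⟨g.trans g', fun a b => ?_, ?_⟩
      · rw [LinearEquiv.trans_apply, LinearEquiv.trans_apply, h1', h1]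
      · rw [← h2', ← h2, wedgeMap_wedgeMap]
        rfl

/-- The set of isomorphism classes of `f`-modules. -/
abbrev FModuleClasses (f : Fin (n + 1) → K) : Type (u + 1) := Quotient (FModule.setoid f)

/-- The pair `v = (A_y, A_x)` of matrices of `ev_y ∘ φ`, `ev_x ∘ φ` with respect to some basis
`b_1, …, b_n` of the `f`-module with `b_1 ∧ ⋯ ∧ b_n = e`. -/
def FModule.HasMatrices {f : Fin (n + 1) → K} (S : FModule f) (v : Vf f) : Prop :=
  ∃ b : Module.Basis (Fin n) K S.M, exteriorPower.ιMulti K n b = S.e ∧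
    v.A = gram f S.φ b 0 1 ∧ v.B = gram f S.φ b 1 0

/-! ### Pairs `(α, z)` -/

/-- The pairs `(α, z) ∈ L_f^× × K^×` with `z² N(α) = f_0^{n+1}`. -/
def NormPair (f : Fin (n + 1) → K) : Type u :=
  {p : (Lf f)ˣ × Kˣ // (p.2 : K) ^ 2 * Algebra.norm K (p.1 : Lf f) = f 0 ^ (n + 1)}

/-- `(α, z)` and `(β² α, N(β)⁻¹ z)` are equivalent, for `β ∈ L_f^×`. -/
instance NormPair.setoid (f : Fin (n + 1) → K) : Setoid (NormPair f) where
  r p p' := ∃ β : (Lf f)ˣ, p'.1.1 = β ^ 2 * p.1.1 ∧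
    p'.1.2 = (Units.map (Algebra.norm K : Lf f →* K) β)⁻¹ * p.1.2
  iseqv := by
    refine ⟨fun p => ⟨1, by simp, by simp⟩, ?_, ?_⟩
    · rintro p p' ⟨β, h1, h2⟩
      refine ⟨β⁻¹, ?_, ?_⟩
      · rw [h1, ← mul_assoc, inv_pow, inv_mul_cancel, one_mul]
      · rw [h2, map_inv, inv_inv, mul_inv_cancel_left]
    · rintro p p' p'' ⟨β, h1, h2⟩ ⟨β', h1', h2'⟩
      refine ⟨β' * β, ?_, ?_⟩
      · rw [h1', h1, mul_pow, mul_assoc]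
      · rw [h2', h2, map_mul, mul_inv, mul_assoc]

/-- The set of equivalence classes of pairs `(α, z)`. -/
abbrev NormPairClasses (f : Fin (n + 1) → K) : Type u := Quotient (NormPair.setoid f)

/-- The pair `(α, z)` is obtained from the `f`-module `(M, φ, e)` and a generator `u` of `M`, given
as the image of `1` under an isomorphism `L_f ≃ M`:
`φ (u ⊗ u) = α y^{n-3}` and `u⁻¹_* e = z (1 ∧ X ∧ ⋯ ∧ X^{n-1})`. -/
def FModule.HasPair {f : Fin (n + 1) → K} (hf0 : f 0 ≠ 0) (S : FModule f) (p : NormPair f) : Prop :=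
  ∃ u : Lf f ≃ₗ[Lf f] S.M,
    S.φ (u 1 ⊗ₜ[Lf f] u 1) = ((p.1.1 : Lf f) • yPow hf0 ((n : ℤ) - 3) : If f) ∧
    wedgeMap f u.symm.toLinearMap S.e = (p.1.2 : K) • powerWedge hf0

end Modules

end PencilOrbits

end

noncomputable section

namespace PencilOrbits

open scoped Matrix Polynomial LaurentPolynomial TensorProduct

/-! Since `f 0 ≠ 0`, the scheme `S_f` lies in `D⁺(y)`. Hence `L_f = K[X]/(f(X,1))` (`lfEquiv`),
`I_f` is `L_f` times `y^{n-3}` (`yEquiv`), and the cohomological functionals become elementary: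
`ev_y (a y^{n-3})` is `τ(a)`, which is `f_0⁻¹` times the coefficient of `X^{n-1}` in `a`, and `ev_x
v = ev_y (X v)` (`ev_y_yEquiv`, `ev_x_eq`). The form `τ(ab)` has an anti-triangular matrix `H` in
the basis of powers of `X`, so it is nondegenerate, of discriminant `f_0^{-n}` (`matDisc_hankel`).

A generator `u` of `M` with `φ(u ⊗ u) = α y^{n-3}` gives the basis `X^i u`, in which the two forms
have matrices `H m_α` and `H m_α m_X`, where `m_a` is multiplication by `a`. As `m_X` has
characteristic polynomial `f(X,1)/f_0`, their invariant form is `N(α) f_0^{-(n+1)} f`. Passing to a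
basis whose wedge is `e` multiplies it by `z²`, so the discriminant condition on an `f`-module is
exactly the norm equation (`invariantForm_gram_eq_iff`). Replacing `u` by `βu` changes `(α, z)` to
`(β²α, N(β)⁻¹z)`. This gives the bijection with pairs.

For orbits, bases with the same wedge differ by `SL_n`. The matrices determine the `f`-module,
because nondegeneracy recovers the action of `X` from `ev_x = ev_y ∘ X`
(`isomorphic_of_hasMatrices`). Conversely, for `(A, B)` in `V_f` the matrix `T = A⁻¹B` has the
separable characteristic polynomial `f(X,1)/f_0`, hence a cyclic vector `w`. The functional `p ↦ wᵗ
A p(T) w` on `L_f` has the form `τ(α ·)`, so in the basis `T^i w` the pair becomes `(H m_α, H m_α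
m_X)` (`exists_hankel_eq`). -/

/-- A relation between two sets which is compatible with equivalence relations on them in the
strongest sense induces a bijection of the quotients. -/
theorem exists_bijective_quotient {α β : Type*} (sα : Setoid α) (sβ : Setoid β) (R : α → β → Prop)
    (hl : ∀ a, ∃ b, R a b) (hr : ∀ b, ∃ a, R a b)
    (hα : ∀ a a' b, R a b → sα a a' → R a' b)
    (hβ : ∀ a b b', R a b → (R a b' ↔ sβ b b'))
    (hinj : ∀ a a' b, R a b → R a' b → sα a a') :
    ∃ Φ : Quotient sα → Quotient sβ, Function.Bijective Φ ∧
      ∀ a b, Φ (Quotient.mk _ a) = Quotient.mk _ b ↔ R a b := by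
  choose F hF using hl
  have hwd : ∀ a a', sα a a' → (Quotient.mk sβ (F a)) = Quotient.mk sβ (F a') := by
    intro a a' h
    exact Quotient.sound ((hβ a' _ _ (hα a a' _ (hF a) h)).1 (hF a'))
  have key : ∀ a b, Quotient.lift (fun a => Quotient.mk sβ (F a)) hwd (Quotient.mk _ a) =
      Quotient.mk _ b ↔ R a b := by
    intro a b
    rw [Quotient.lift_mk, Quotient.eq, hβ a _ _ (hF a)]
  refine ⟨Quotient.lift (fun a => Quotient.mk sβ (F a)) hwd, ⟨?_, ?_⟩, key⟩
  · intro p q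
    induction p using Quotient.inductionOn with | _ a
    induction q using Quotient.inductionOn with | _ a'
    intro h
    have h2 : Quotient.lift (fun a => Quotient.mk sβ (F a)) hwd (Quotient.mk _ a') =
      Quotient.mk _ (F a') := rfl
    exact Quotient.sound (hinj a a' (F a') ((key _ _).1 (h.trans h2)) (hF a'))
  · intro q
    induction q using Quotient.inductionOn with | _ b
    obtain ⟨a, ha⟩ := hr b
    exact ⟨Quotient.mk _ a, (key a b).2 ha⟩

/-! ### Determinants of anti-triangular matrices. -/

theorem neg_one_pow_half_succ (R : Type*) [CommRing R] (n : ℕ) :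
    (-1 : R) ^ ((n + 1) * (n + 1 - 1) / 2) = (-1) ^ n * (-1) ^ (n * (n - 1) / 2) := by
  rw [← pow_add]
  congr 1
  have := Finset.sum_range_succ (fun i => i) n
  rw [Finset.sum_range_id, Finset.sum_range_id] at this
  omega

/-- Expansion along the first row leaves only the last column, with sign `(-1)^n`. The total sign is
the one in `matDisc`, so the two cancel in `matDisc_hankel`. -/
theorem det_antitriangular {R : Type*} [CommRing R] {n : ℕ} (H : Matrix (Fin n) (Fin n) R) (c : R)
    (h0 : ∀ i j : Fin n, (i : ℕ) + j + 1 < n → H i j = 0)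
    (hc : ∀ i j : Fin n, (i : ℕ) + j + 1 = n → H i j = c) :
    H.det = (-1) ^ (n * (n - 1) / 2) * c ^ n := by
  induction n with
  | zero => simp
  | succ n ih =>
    rw [Matrix.det_succ_row_zero, Finset.sum_eq_single (Fin.last n)]
    · rw [hc _ _ (by simp), Fin.succAbove_last, ih, neg_one_pow_half_succ]
      · simp only [Fin.val_last]
        ring
      · intro i j hij
        exact h0 _ _ (by simp; omega)
      · intro i j hij
        exact hc _ _ (by simp; omega)
    · intro j _ hj
      rw [h0 _ _, mul_zero, zero_mul]
      have : (j : ℕ) ≠ n := fun h => hj (Fin.ext h)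
      simp
      omega
    · simp

/-! ### Invariant forms and characteristic polynomials. -/

section Forms

variable {K : Type u} [Field K] {n : ℕ}

theorem eval_formPoly (f : Fin (n + 1) → K) (x : Fin 2 → K) :
    MvPolynomial.eval x (formPoly f) =
      ∑ i : Fin (n + 1), f i * x 0 ^ (n - (i : ℕ)) * x 1 ^ (i : ℕ) := by
  simp [formPoly]

theorem eval_invariantForm (A B : Matrix (Fin n) (Fin n) K) (x : Fin 2 → K) :
    MvPolynomial.eval x (invariantForm A B) = matDisc (x 0 • A - x 1 • B) := by
  unfold invariantForm matDisc
  rw [map_mul, RingHom.map_det]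
  congr 1
  · simp
  · congr 1
    ext i j
    simp

theorem formPoly_ne_zero {f : Fin (n + 1) → K} (hf0 : f 0 ≠ 0) : formPoly f ≠ 0 := by
  intro h
  have h1 := congrArg (MvPolynomial.eval ![1, 0]) h
  rw [eval_formPoly, Finset.sum_eq_single 0] at h1
  · simp at h1
    exact hf0 h1
  · intro j _ hj
    have : (j : ℕ) ≠ 0 := fun h => hj (Fin.ext h)
    simp [this]
  · simp

theorem eval_dehomY (f : Fin (n + 1) → K) (a : K) :
    (dehomY f).eval a = ∑ i : Fin (n + 1), f i * a ^ (n - (i : ℕ)) := by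
  simp [dehomY, Polynomial.eval_finsetSum]

theorem eval_formPoly_of_ne_zero (f : Fin (n + 1) → K) (x : Fin 2 → K) (hx : x 1 ≠ 0) :
    MvPolynomial.eval x (formPoly f) = x 1 ^ n * (dehomY f).eval (x 0 / x 1) := by
  rw [eval_formPoly, eval_dehomY, Finset.mul_sum]
  refine Finset.sum_congr rfl fun i _ => ?_
  have : x 1 ^ n = x 1 ^ (n - (i : ℕ)) * x 1 ^ (i : ℕ) := by
    rw [← pow_add]; congr 1; have := i.2; omega
  rw [this, div_pow]
  field_simp

theorem eval_formPoly_of_eq_zero (f : Fin (n + 1) → K) (x : Fin 2 → K) (hx : x 1 = 0) :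
    MvPolynomial.eval x (formPoly f) = f 0 * x 0 ^ n := by
  rw [eval_formPoly, hx, Finset.sum_eq_single 0]
  · simp
  · intro j _ hj
    have : (j : ℕ) ≠ 0 := fun h => hj (Fin.ext h)
    simp [this]
  · simp

theorem matDisc_smul (c : K) (A : Matrix (Fin n) (Fin n) K) :
    matDisc (c • A) = c ^ n * matDisc A := by
  simp only [matDisc, Matrix.det_smul, Fintype.card_fin]
  ring

theorem matDisc_mul (A B : Matrix (Fin n) (Fin n) K) :
    matDisc (A * B) = matDisc A * B.det := by
  simp only [matDisc, Matrix.det_mul, mul_assoc]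

theorem matDisc_congr (P A : Matrix (Fin n) (Fin n) K) :
    matDisc (Pᵀ * A * P) = P.det ^ 2 * matDisc A := by
  simp only [matDisc, Matrix.det_mul, Matrix.det_transpose]
  ring

theorem matDisc_of_invariantForm_eq {f : Fin (n + 1) → K} {A B : Matrix (Fin n) (Fin n) K}
    (h : invariantForm A B = formPoly f) : matDisc A = f 0 := by
  have h1 := congrArg (MvPolynomial.eval ![1, 0]) h
  rw [eval_invariantForm, eval_formPoly_of_eq_zero _ _ (by simp)] at h1
  simpa using h1

variable [CharZero K]

/-- Characteristic zero makes `K` infinite, so equality of forms can be tested at points of `K²`. -/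
theorem invariantForm_congr (P A B : Matrix (Fin n) (Fin n) K) :
    invariantForm (Pᵀ * A * P) (Pᵀ * B * P) = MvPolynomial.C (P.det ^ 2) * invariantForm A B := by
  refine MvPolynomial.funext fun x => ?_
  rw [map_mul, MvPolynomial.eval_C, eval_invariantForm, eval_invariantForm, ← matDisc_congr]
  congr 1
  simp only [Matrix.mul_sub, Matrix.sub_mul, Matrix.mul_smul, Matrix.smul_mul]

/-- The invariant form of `(A, A T)` is determined by the characteristic polynomial of `T`. -/
theorem invariantForm_mul {f : Fin (n + 1) → K} (hf0 : f 0 ≠ 0) (A T : Matrix (Fin n) (Fin n) K)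
    (hT : Polynomial.C (f 0) * T.charpoly = dehomY f) :
    invariantForm A (A * T) = MvPolynomial.C (matDisc A / f 0) * formPoly f := by
  refine MvPolynomial.funext fun x => ?_
  rw [map_mul, MvPolynomial.eval_C, eval_invariantForm]
  -- Off `y = 0` one has `xA - yAT = yA(x/y - T)`, which brings in the characteristic polynomial at
  -- `x/y`; on `y = 0` only `f_0 x^n` is left.
  by_cases hx : x 1 = 0
  · rw [eval_formPoly_of_eq_zero _ _ hx, hx, zero_smul, sub_zero, matDisc_smul]
    field_simp
  · rw [eval_formPoly_of_ne_zero _ _ hx, ← hT, Polynomial.eval_mul, Polynomial.eval_C,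
      Matrix.eval_charpoly]
    have : x 0 • A - x 1 • (A * T) = x 1 • (A * (Matrix.scalar (Fin n) (x 0 / x 1) - T)) := by
      rw [Matrix.mul_sub, smul_sub, Matrix.scalar_apply, ← Matrix.smul_one_eq_diagonal,
        Matrix.mul_smul, Matrix.mul_one, smul_smul, mul_div_cancel₀ _ hx]
    rw [this, matDisc_smul, matDisc_mul]
    field_simp

theorem charpoly_of_invariantForm_eq {f : Fin (n + 1) → K} {A T : Matrix (Fin n) (Fin n) K}
    (h : invariantForm A (A * T) = formPoly f) : Polynomial.C (f 0) * T.charpoly = dehomY f := by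
  refine Polynomial.funext fun a => ?_
  have h1 := congrArg (MvPolynomial.eval ![a, 1]) h
  rw [eval_invariantForm, eval_formPoly_of_ne_zero _ _ (by simp)] at h1
  rw [Polynomial.eval_mul, Polynomial.eval_C, Matrix.eval_charpoly,
    ← matDisc_of_invariantForm_eq h, ← matDisc_mul, Matrix.mul_sub, Matrix.scalar_apply,
    ← Matrix.smul_one_eq_diagonal, Matrix.mul_smul, Matrix.mul_one]
  simpa using h1

end Forms

/-! ### Top exterior powers and determinants. -/

section Wedge

variable {K : Type*} [Field K] {n : ℕ} {M : Type*} [AddCommGroup M] [Module K M]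

/-- Two alternating maps agree once they agree on injective tuples of basis vectors, which are
permutations of the basis. -/
theorem ιMulti_eq_det_smul (b : Module.Basis (Fin n) K M) (v : Fin n → M) :
    exteriorPower.ιMulti K n v = b.det v • exteriorPower.ιMulti K n b := by
  classical
  have : exteriorPower.ιMulti K n =
      (LinearMap.toSpanSingleton K _ (exteriorPower.ιMulti K n b)).compAlternatingMap b.det := by
    refine Module.Basis.ext_alternating b fun i hi => ?_
    let σ : Equiv.Perm (Fin n) := Equiv.ofBijective i (Finite.injective_iff_bijective.1 hi)
    change exteriorPower.ιMulti K n (b ∘ σ) = b.det (b ∘ σ) • _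
    rw [AlternatingMap.map_perm, AlternatingMap.map_perm, b.det_self, smul_assoc, one_smul]
  exact congrArg (fun g => g v) this

theorem ιMulti_basis_ne_zero (b : Module.Basis (Fin n) K M) : exteriorPower.ιMulti K n b ≠ 0 := by
  intro h
  have h1 := exteriorPower.alternatingMapLinearEquiv_apply_ιMulti b.det b
  rw [h, map_zero, b.det_self] at h1
  exact zero_ne_one h1

theorem exists_eq_smul_ιMulti (b : Module.Basis (Fin n) K M) (e : ⋀[K]^n M) :
    ∃ c : K, e = c • exteriorPower.ιMulti K n b := by
  have h : e ∈ Submodule.span K (Set.range (exteriorPower.ιMulti K n (M := M))) := by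
    rw [exteriorPower.ιMulti_span]; trivial
  induction h using Submodule.span_induction with
  | mem x hx =>
    obtain ⟨v, rfl⟩ := hx
    exact ⟨_, ιMulti_eq_det_smul b v⟩
  | zero => exact ⟨0, (zero_smul _ _).symm⟩
  | add x y _ _ hx hy =>
    obtain ⟨c, rfl⟩ := hx
    obtain ⟨d, rfl⟩ := hy
    exact ⟨c + d, (add_smul _ _ _).symm⟩
  | smul a x _ hx =>
    obtain ⟨c, rfl⟩ := hx
    exact ⟨a * c, by rw [mul_smul]⟩

theorem exists_basis_ιMulti_eq (hn : 0 < n) (b : Module.Basis (Fin n) K M) {e : ⋀[K]^n M}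
    (he : e ≠ 0) : ∃ b' : Module.Basis (Fin n) K M, exteriorPower.ιMulti K n b' = e := by
  obtain ⟨c, rfl⟩ := exists_eq_smul_ιMulti b e
  have hc : c ≠ 0 := by
    rintro rfl
    exact he (zero_smul _ _)
  -- Rescaling the first basis vector alone multiplies the wedge by `c`.
  let w : Fin n → Kˣ := fun i => if (i : ℕ) = 0 then Units.mk0 c hc else 1
  refine ⟨b.unitsSMul w, ?_⟩
  rw [ιMulti_eq_det_smul b, b.det_unitsSMul_self, Finset.prod_eq_single ⟨0, hn⟩]
  · simp [w]
  · intro i _ hi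
    have : (i : ℕ) ≠ 0 := fun h => hi (Fin.ext h)
    simp [w, this]
  · simp

theorem ιMulti_comp_linearMap (b : Module.Basis (Fin n) K M) (g : M →ₗ[K] M) :
    exteriorPower.map n g (exteriorPower.ιMulti K n b) =
      LinearMap.det g • exteriorPower.ιMulti K n b := by
  rw [exteriorPower.map_apply_ιMulti, ιMulti_eq_det_smul b, b.det_comp, b.det_self, mul_one]

end Wedge

/-! ### The algebra `L_f`, the functionals `ev`, and the Hankel form. -/

section Algebra

variable {K : Type u} [Field K] {n : ℕ} {f : Fin (n + 1) → K}

theorem coeff_dehomY (f : Fin (n + 1) → K) (m : ℕ) (hm : m < n + 1) :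
    (dehomY f).coeff m = f ⟨n - m, by omega⟩ := by
  simp only [dehomY, Polynomial.finsetSum_coeff, Polynomial.coeff_C_mul, Polynomial.coeff_X_pow]
  rw [Finset.sum_eq_single ⟨n - m, by omega⟩]
  · rw [if_pos (by simp; omega), mul_one]
  · intro j _ hj
    rw [if_neg, mul_zero]
    intro h
    exact hj (Fin.ext (by simp; omega))
  · simp

theorem natDegree_dehomY_le (f : Fin (n + 1) → K) : (dehomY f).natDegree ≤ n := by
  refine Polynomial.natDegree_sum_le_of_forall_le _ _ fun i _ => ?_
  exact (Polynomial.natDegree_C_mul_X_pow_le _ _).trans (Nat.sub_le _ _)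

theorem natDegree_dehomY (hf0 : f 0 ≠ 0) : (dehomY f).natDegree = n := by
  refine le_antisymm (natDegree_dehomY_le f) (Polynomial.le_natDegree_of_ne_zero ?_)
  rw [coeff_dehomY f n (by omega)]
  simpa using hf0

theorem leadingCoeff_dehomY (hf0 : f 0 ≠ 0) : (dehomY f).leadingCoeff = f 0 := by
  rw [Polynomial.leadingCoeff, natDegree_dehomY hf0, coeff_dehomY f n (by omega)]
  simp

theorem dehomY_ne_zero (hf0 : f 0 ≠ 0) : dehomY f ≠ 0 := by
  intro h
  have := leadingCoeff_dehomY hf0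
  rw [h, Polynomial.leadingCoeff_zero] at this
  exact hf0 this.symm

/-- Passing to the overlap inverts `y/x`, which is already a unit on `S_f ∩ D⁺(x)` because `f_0 ≠
0`; so nothing is killed. -/
theorem resX_injective (hf0 : f 0 ≠ 0) : Function.Injective (resX f) := by
  rw [injective_iff_map_eq_zero]
  intro q hq
  obtain ⟨Q, rfl⟩ := AdjoinRoot.mk_surjective q
  rw [resX_mk, Ideal.Quotient.eq_zero_iff_mem, Ideal.mem_span_singleton, dehomXY_eq] at hq
  obtain ⟨h, hh⟩ := hq
  have hh' := congrArg LaurentPolynomial.invert hh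
  have hinv : ∀ g : K[T;T⁻¹], LaurentPolynomial.invert (LaurentPolynomial.invert g) = g :=
    LaurentPolynomial.involutive_invert
  rw [map_mul, map_mul, hinv, hinv, LaurentPolynomial.invert_T] at hh'
  -- A power of the coordinate clears denominators and turns the identity of Laurent polynomials
  -- into one of polynomials.
  obtain ⟨m, g, hg⟩ := (LaurentPolynomial.T (-(n : ℤ)) * LaurentPolynomial.invert h).exists_T_pow
  have h1 : Polynomial.toLaurent (Q * Polynomial.X ^ m) = Polynomial.toLaurent (dehomX f * g) := by
    rw [map_mul, map_mul, Polynomial.toLaurent_X_pow, hg, hh']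
    ring
  have h2 := Polynomial.toLaurent_injective h1
  have h3 := congrArg (AdjoinRoot.mk (dehomX f)) h2
  rw [map_mul, map_mul, AdjoinRoot.mk_self, zero_mul, map_pow, AdjoinRoot.mk_X] at h3
  exact ((isUnit_root_dehomX hf0).pow m).mul_left_eq_zero.1 h3

theorem resX_surjective (hf0 : f 0 ≠ 0) : Function.Surjective (resX f) := by
  intro y
  obtain ⟨g, rfl⟩ := Ideal.Quotient.mk_surjective y
  have hT : ∀ k : ℤ, ∃ q, resX f q = tPow f k := by
    intro k
    refine ⟨((isUnit_root_dehomX hf0).unit ^ (-k) : (ChartX f)ˣ), ?_⟩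
    have h := resX_unit_zpow hf0 (-k)
    have h2 := congrArg (tPow f k * ·) h
    simpa [← mul_assoc, ← tPow_add, tPow_zero] using h2
  induction g using LaurentPolynomial.induction_on_mul_T with
  | _ p k =>
  obtain ⟨q, hq⟩ := hT (-(k : ℤ))
  obtain ⟨q', hq'⟩ := hT 1
  refine ⟨Polynomial.aeval q' p * q, ?_⟩
  rw [map_mul, hq, map_mul, ← Polynomial.aeval_algHom_apply, hq']
  change _ = _ * tPow f _
  rw [← eval_tPow_one]
  rfl

/-- `L_f` is the ring of functions on `S_f ∩ D⁺(y)`. -/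
def lfEquiv (hf0 : f 0 ≠ 0) : Lf f ≃ₐ[K] ChartY f :=
  AlgEquiv.ofBijective ((AlgHom.fst K (ChartY f) (ChartX f)).comp (Lf f).val) (by
    constructor
    · intro a b hab
      have h : a.1.1 = b.1.1 := hab
      refine Subtype.ext (Prod.ext h (resX_injective hf0 ?_))
      rw [← (mem_Lf f _).1 a.2, ← (mem_Lf f _).1 b.2, h]
    · intro p
      obtain ⟨q, hq⟩ := resX_surjective hf0 (resY f p)
      exact ⟨⟨(p, q), hq.symm⟩, rfl⟩)

theorem lfEquiv_xOverY (hf0 : f 0 ≠ 0) :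
    lfEquiv hf0 (xOverY hf0) = AdjoinRoot.root (dehomY f) := rfl

/-- The power basis of `L_f` with generator `X`. -/
def lfPowerBasis (hf0 : f 0 ≠ 0) : PowerBasis K (Lf f) :=
  (AdjoinRoot.powerBasis (dehomY_ne_zero hf0)).map (lfEquiv hf0).symm

theorem lfPowerBasis_gen (hf0 : f 0 ≠ 0) : (lfPowerBasis hf0).gen = xOverY hf0 := by
  rw [lfPowerBasis, PowerBasis.map_gen, AdjoinRoot.powerBasis_gen, ← lfEquiv_xOverY hf0,
    AlgEquiv.symm_apply_apply]

theorem lfPowerBasis_dim (hf0 : f 0 ≠ 0) : (lfPowerBasis hf0).dim = n := by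
  rw [lfPowerBasis, PowerBasis.map_dim, AdjoinRoot.powerBasis_dim, natDegree_dehomY hf0]

/-- The basis `1, X, …, X^{n-1}` of `L_f`. -/
def lfBasis (hf0 : f 0 ≠ 0) : Module.Basis (Fin n) K (Lf f) :=
  (lfPowerBasis hf0).basis.reindex (finCongr (lfPowerBasis_dim hf0))

theorem lfBasis_apply (hf0 : f 0 ≠ 0) (i : Fin n) : lfBasis hf0 i = xOverY hf0 ^ (i : ℕ) := by
  rw [lfBasis, Module.Basis.reindex_apply, PowerBasis.basis_eq_pow, lfPowerBasis_gen]
  rfl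

theorem powerWedge_eq (hf0 : f 0 ≠ 0) :
    powerWedge hf0 = exteriorPower.ιMulti K n (lfBasis hf0) := by
  rw [powerWedge]
  congr 1
  ext1 i
  exact (lfBasis_apply hf0 i).symm

theorem minpoly_xOverY (hf0 : f 0 ≠ 0) :
    Polynomial.C (f 0) * minpoly K (xOverY hf0) = dehomY f := by
  rw [← minpoly.algEquiv_eq (lfEquiv hf0), lfEquiv_xOverY,
    AdjoinRoot.minpoly_root (dehomY_ne_zero hf0),
    leadingCoeff_dehomY hf0, mul_left_comm, ← Polynomial.C_mul, mul_inv_cancel₀ hf0,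
    Polynomial.C_1, mul_one]

theorem charpoly_leftMulMatrix_xOverY (hf0 : f 0 ≠ 0) :
    Polynomial.C (f 0) * (Algebra.leftMulMatrix (lfBasis hf0) (xOverY hf0)).charpoly =
      dehomY f := by
  have h : (Algebra.leftMulMatrix (lfBasis hf0) (xOverY hf0)).charpoly =
      minpoly K (xOverY hf0) := by
    have : Module.Finite K (Lf f) := Module.Finite.of_basis (lfBasis hf0)
    -- `lfBasis` is a reindexing of the power basis; both matrices are compared through the
    -- characteristic polynomial of the linear map.
    rw [← lfPowerBasis_gen hf0, ← charpoly_leftMulMatrix]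
    exact (LinearMap.charpoly_toMatrix (Algebra.lmul K (Lf f) _) _).trans
      (LinearMap.charpoly_toMatrix _ _).symm
  rw [h, minpoly_xOverY hf0]

theorem nontrivial_Lf (hf0 : f 0 ≠ 0) (hn : 0 < n) : Nontrivial (Lf f) := by
  have := Module.nontrivial_of_finrank_pos (R := K) (M := Lf f)
    (by rw [Module.finrank_eq_card_basis (lfBasis hf0), Fintype.card_fin]; exact hn)
  exact this

theorem H0_ext (hf0 : f 0 ≠ 0) {k : ℤ} {v w : H0 f k} (h : v.1.1 = w.1.1) : v = w := by
  refine Subtype.ext (Prod.ext h (resX_injective hf0 ?_))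
  have hv := (mem_H0 f k _).1 v.2
  have hw := (mem_H0 f k _).1 w.2
  rw [h, hw] at hv
  have := congrArg (tPow f (-k) * ·) hv
  simpa [← mul_assoc, ← tPow_add, tPow_zero] using this.symm

/-- The isomorphism `L_f ≃ H⁰(S_f, 𝒪(k))` given by the generator `y ^ k`. -/
def yEquiv (hf0 : f 0 ≠ 0) (k : ℤ) : Lf f ≃ₗ[Lf f] H0 f k :=
  LinearEquiv.ofBijective (LinearMap.toSpanSingleton (Lf f) (H0 f k) (yPow hf0 k)) (by
    constructor
    · intro a b hab
      refine (lfEquiv hf0).injective ?_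
      have h : a.1.1 * 1 = b.1.1 * 1 := congrArg (fun s : H0 f k => s.1.1) hab
      rw [mul_one, mul_one] at h
      exact h
    · intro s
      refine ⟨(lfEquiv hf0).symm s.1.1, H0_ext hf0 ?_⟩
      have h1 : ((lfEquiv hf0).symm s.1.1).1.1 = s.1.1 := (lfEquiv hf0).apply_symm_apply s.1.1
      change ((lfEquiv hf0).symm s.1.1).1.1 * 1 = s.1.1
      rw [mul_one, h1])

/-- The functional on `L_f` which reads off `f_0⁻¹` times the coefficient of `X^{n-1}`. -/
def topCoeff (hf0 : f 0 ≠ 0) (hn : 0 < n) : Lf f →ₗ[K] K :=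
  (f 0)⁻¹ • (lfBasis hf0).coord ⟨n - 1, by omega⟩

theorem topCoeff_pow (hf0 : f 0 ≠ 0) (hn : 0 < n) (k : ℕ) (hk : k < n) :
    topCoeff hf0 hn (xOverY hf0 ^ k) = if k + 1 = n then (f 0)⁻¹ else 0 := by
  have h : xOverY hf0 ^ k = lfBasis hf0 ⟨k, hk⟩ := (lfBasis_apply hf0 ⟨k, hk⟩).symm
  rw [h, topCoeff, LinearMap.smul_apply, Module.Basis.coord_apply, Module.Basis.repr_self,
    Finsupp.single_apply]
  have : ((⟨k, hk⟩ : Fin n) = ⟨n - 1, by omega⟩) ↔ k + 1 = n := by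
    rw [Fin.mk.injEq]; omega
  simp [this]

theorem f_ne_zero (hf0 : f 0 ≠ 0) : f ≠ 0 := fun h => hf0 (by rw [h]; rfl)

/-- A section is determined by its restriction to `D⁺(y)`, so the class of `Q` on the other chart
need not be checked. -/
theorem isBoundary_of_eq (hf0 : f 0 ≠ 0) {k : ℤ} {s : H0 f k} {P Q : K[X]} {h : K[T;T⁻¹]}
    (hP : AdjoinRoot.mk (dehomY f) P = s.1.1)
    (e : Polynomial.toLaurent P -
        LaurentPolynomial.T k * LaurentPolynomial.invert (Polynomial.toLaurent Q) =
      dehomXY f * h) : IsBoundary f k s h := by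
  refine ⟨P, Q, hP, ?_, e⟩
  have h1 : resY f (AdjoinRoot.mk _ P) = tPow f k * resX f (AdjoinRoot.mk _ Q) := by
    rw [resY_mk, resX_mk, tPow, ← map_mul, Ideal.Quotient.eq, Ideal.mem_span_singleton]
    exact ⟨h, e⟩
  let s' : H0 f k := ⟨(AdjoinRoot.mk _ P, AdjoinRoot.mk _ Q), h1⟩
  have : s' = s := H0_ext hf0 hP
  rw [← this]

theorem isBoundary_add {k : ℤ} {s s' : H0 f k} {h h' : K[T;T⁻¹]} (hs : IsBoundary f k s h)
    (hs' : IsBoundary f k s' h') : IsBoundary f k (s + s') (h + h') := by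
  obtain ⟨P, Q, hP, hQ, e⟩ := hs
  obtain ⟨P', Q', hP', hQ', e'⟩ := hs'
  refine ⟨P + P', Q + Q', ?_, ?_, ?_⟩
  · rw [map_add, hP, hP']; rfl
  · rw [map_add, hQ, hQ']; rfl
  · rw [map_add, map_add, map_add, mul_add, mul_add, ← e, ← e']
    ring

theorem isBoundary_smul {k : ℤ} {s : H0 f k} {h : K[T;T⁻¹]} (c : K) (hs : IsBoundary f k s h) :
    IsBoundary f k (algebraMap K (Lf f) c • s) (LaurentPolynomial.C c * h) := by
  obtain ⟨P, Q, hP, hQ, e⟩ := hs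
  refine ⟨Polynomial.C c * P, Polynomial.C c * Q, ?_, ?_, ?_⟩
  · rw [map_mul, hP]; rfl
  · rw [map_mul, hQ]; rfl
  · simp only [map_mul, Polynomial.toLaurent_C, LaurentPolynomial.invert_C]
    rw [mul_left_comm (dehomXY f), ← e]
    ring

theorem ev_add (hf0 : f 0 ≠ 0) (r s : K) (v w : If f) :
    ev f r s (v + w) = ev f r s v + ev f r s w := by
  obtain ⟨h, hh⟩ := exists_isBoundary f _ v
  obtain ⟨h', hh'⟩ := exists_isBoundary f _ w
  rw [ev_eq (f_ne_zero hf0) r s _ hh, ev_eq (f_ne_zero hf0) r s _ hh',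
    ev_eq (f_ne_zero hf0) r s _ (isBoundary_add hh hh'), mul_add, AddMonoidAlgebra.coeff_add,
    Finsupp.add_apply]

theorem ev_smul (hf0 : f 0 ≠ 0) (r s c : K) (v : If f) :
    ev f r s (algebraMap K (Lf f) c • v) = c * ev f r s v := by
  obtain ⟨h, hh⟩ := exists_isBoundary f _ v
  rw [ev_eq (f_ne_zero hf0) r s _ hh, ev_eq (f_ne_zero hf0) r s _ (isBoundary_smul c hh),
    mul_left_comm, ← LaurentPolynomial.single_eq_C, AddMonoidAlgebra.coeff_single_mul_apply,
    neg_zero, zero_add]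

theorem dehomX_eq (f : Fin (n + 1) → K) :
    dehomX f = Polynomial.X * (dehomX f).divX + Polynomial.C (f 0) := by
  conv_lhs => rw [← Polynomial.X_mul_divX_add (dehomX f)]
  congr 2
  simp only [dehomX, Polynomial.finsetSum_coeff, Polynomial.coeff_C_mul, Polynomial.coeff_X_pow]
  rw [Finset.sum_eq_single 0]
  · simp
  · intro j _ hj
    have : 0 ≠ (j : ℕ) := fun h => hj (Fin.ext h.symm)
    simp [this]
  · simp

/-- `ev_x (v) = ev_y (X v)`. -/
theorem ev_x_eq (hf0 : f 0 ≠ 0) (v : If f) : ev f 1 0 v = ev f 0 1 (xOverY hf0 • v) := by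
  obtain ⟨h, P, Q, hP, hQ, e⟩ := exists_isBoundary f _ v
  -- To lift `X v` on `D⁺(x)`, the lift `Q` must be divided by `y/x`. A multiple of `f(1, ·)`, whose
  -- constant term is `f_0 ≠ 0`, first removes the constant term of `Q`.
  have hQ0 : ∃ Q' : K[X], Q = Polynomial.X * Q' +
      Polynomial.C (Q.coeff 0 * (f 0)⁻¹) * dehomX f := by
    refine ⟨Q.divX - Polynomial.C (Q.coeff 0 * (f 0)⁻¹) * (dehomX f).divX, ?_⟩
    have : Polynomial.C (Q.coeff 0) = Polynomial.C (Q.coeff 0 * (f 0)⁻¹) * Polynomial.C (f 0) := by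
      rw [← Polynomial.C_mul, inv_mul_cancel_right₀ hf0]
    linear_combination -Polynomial.X_mul_divX_add Q + this -
      Polynomial.C (Q.coeff 0 * (f 0)⁻¹) * dehomX_eq f
  obtain ⟨Q', hQ'⟩ := hQ0
  set c := Q.coeff 0 * (f 0)⁻¹
  -- The correction adds `c t⁻³` to the cocycle. After multiplication by `t` it sits in degree `-2`
  -- and does not affect the coefficient of `t⁻¹`.
  have hb : IsBoundary f _ (xOverY hf0 • v) (LaurentPolynomial.T 1 *
      (h + LaurentPolynomial.C c * LaurentPolynomial.T (-3))) := by
    refine isBoundary_of_eq hf0 (P := Polynomial.X * P) (Q := Q') ?_ ?_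
    · rw [map_mul, hP, AdjoinRoot.mk_X]; rfl
    · rw [map_mul, Polynomial.toLaurent_X, mul_left_comm, mul_add, ← e]
      conv_rhs => rw [hQ']
      simp only [map_add, map_mul, Polynomial.toLaurent_X, Polynomial.toLaurent_C,
        LaurentPolynomial.invert_C, LaurentPolynomial.invert_T, dehomXY_eq]
      have h1 : (LaurentPolynomial.T 1 * LaurentPolynomial.T (-1) : K[T;T⁻¹]) = 1 := by
        rw [← LaurentPolynomial.T_add]; exact LaurentPolynomial.T_zero
      have h2 : (LaurentPolynomial.T ((n : ℤ) - 3) : K[T;T⁻¹]) =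
          LaurentPolynomial.T n * LaurentPolynomial.T (-3) := by
        rw [← LaurentPolynomial.T_add]; rfl
      rw [h2]
      linear_combination LaurentPolynomial.T (n : ℤ) * LaurentPolynomial.T (-3) *
        LaurentPolynomial.invert (Polynomial.toLaurent Q') * h1
  rw [ev_eq (f_ne_zero hf0) 1 0 v ⟨P, Q, hP, hQ, e⟩, ev_eq (f_ne_zero hf0) 0 1 _ hb,
    coeff_linear_mul, coeff_linear_mul, coeff_T_mul, coeff_T_mul, AddMonoidAlgebra.coeff_add,
    Finsupp.add_apply, coeff_C_mul_T]
  norm_num [coeff_C_mul_T]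

/-- For `k ≤ n - 3` the section lifts to the global monomial `x^k y^{n-3-k}` on `ℙ¹`, so its
boundary vanishes. -/
theorem isBoundary_pow_of_lt (hf0 : f 0 ≠ 0) (k : ℕ) (hk : k + 2 < n) :
    IsBoundary f _ (xOverY hf0 ^ k • yPow hf0 ((n : ℤ) - 3)) 0 := by
  refine isBoundary_of_eq hf0 (P := Polynomial.X ^ k) (Q := Polynomial.X ^ (n - 3 - k)) ?_ ?_
  · rw [map_pow, AdjoinRoot.mk_X]
    exact (mul_one _).symm
  · simp only [Polynomial.toLaurent_X_pow, LaurentPolynomial.invert_T]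
    rw [← LaurentPolynomial.T_add, mul_zero, sub_eq_zero]
    congr 1
    omega

theorem isBoundary_pow (hf0 : f 0 ≠ 0) (k : ℕ) (hk : k + 2 = n) :
    IsBoundary f _ (xOverY hf0 ^ k • yPow hf0 ((n : ℤ) - 3))
      (LaurentPolynomial.C (f 0)⁻¹ * LaurentPolynomial.T (-2)) := by
  -- The section is `x^{n-2} y⁻¹`. On `D⁺(x)` the relation `f(1, s) = 0` gives `s⁻¹ = -f_0⁻¹ (f(1,
  -- s) - f_0)/s`, which is the choice of `Q`.
  refine isBoundary_of_eq hf0 (P := Polynomial.X ^ k)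
    (Q := - Polynomial.C (f 0)⁻¹ * (dehomX f).divX) ?_ ?_
  · rw [map_pow, AdjoinRoot.mk_X]
    exact (mul_one _).symm
  · rw [dehomXY_eq]
    conv_rhs => rw [dehomX_eq f]
    simp only [map_add, map_mul, map_neg, Polynomial.toLaurent_X, Polynomial.toLaurent_C,
      LaurentPolynomial.invert_C, LaurentPolynomial.invert_T, Polynomial.toLaurent_X_pow]
    have h2 : (LaurentPolynomial.T ((n : ℤ) - 3) : K[T;T⁻¹]) =
        LaurentPolynomial.T n * LaurentPolynomial.T (-2) * LaurentPolynomial.T (-1) := by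
      rw [← LaurentPolynomial.T_add, ← LaurentPolynomial.T_add]
      congr 1
      ring
    have h3 : (LaurentPolynomial.T (k : ℤ) : K[T;T⁻¹]) =
        LaurentPolynomial.T n * LaurentPolynomial.T (-2) := by
      rw [← LaurentPolynomial.T_add]
      congr 1
      omega
    have h4 : (LaurentPolynomial.C (f 0) * LaurentPolynomial.C (f 0)⁻¹ : K[T;T⁻¹]) = 1 := by
      rw [← map_mul, mul_inv_cancel₀ hf0, map_one]
    rw [h2, h3]
    linear_combination (-LaurentPolynomial.T (n : ℤ) * LaurentPolynomial.T (-2)) * h4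

theorem ev_y_pow (hf0 : f 0 ≠ 0) (hn : 2 ≤ n) (k : ℕ) (hk : k < n) :
    ev f 0 1 (xOverY hf0 ^ k • yPow hf0 ((n : ℤ) - 3)) =
      topCoeff hf0 (by omega) (xOverY hf0 ^ k) := by
  rw [topCoeff_pow _ _ _ hk]
  split_ifs with h1
  -- For the top power `k = n - 1`, one factor `X` is traded for `ev_x`, which reads the coefficient
  -- of `t⁻²` in the cocycle of `X^{n-2} y^{n-3}`.
  · obtain ⟨m, rfl⟩ : ∃ m, k = m + 1 := ⟨k - 1, by omega⟩
    rw [pow_succ', mul_smul, ← ev_x_eq,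
      ev_eq (f_ne_zero hf0) _ _ _ (isBoundary_pow hf0 m (by omega)),
      coeff_linear_mul, coeff_C_mul_T, coeff_C_mul_T]
    norm_num
  · by_cases h2 : k + 2 = n
    · rw [ev_eq (f_ne_zero hf0) _ _ _ (isBoundary_pow hf0 k h2), coeff_linear_mul, coeff_C_mul_T,
        coeff_C_mul_T]
      norm_num
    · rw [ev_eq (f_ne_zero hf0) _ _ _ (isBoundary_pow_of_lt hf0 k (by omega)), mul_zero]
      rfl

theorem ev_y_yEquiv (hf0 : f 0 ≠ 0) (hn : 2 ≤ n) (a : Lf f) :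
    ev f 0 1 (yEquiv hf0 _ a) = topCoeff hf0 (by omega) a := by
  let g : Lf f →ₗ[K] K :=
    { toFun := fun a => ev f 0 1 (yEquiv hf0 _ a)
      map_add' := fun a b => by rw [map_add, ev_add hf0]
      map_smul' := fun c a => by
        rw [Algebra.smul_def, ← smul_eq_mul, map_smul, ev_smul hf0]
        rfl }
  have : g = topCoeff hf0 (by omega) := by
    refine (lfBasis hf0).ext fun i => ?_
    rw [lfBasis_apply]
    exact ev_y_pow hf0 hn i i.2
  exact congrArg (fun g => g a) this

theorem ev_x_yEquiv (hf0 : f 0 ≠ 0) (hn : 2 ≤ n) (a : Lf f) :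
    ev f 1 0 (yEquiv hf0 _ a) = topCoeff hf0 (by omega) (xOverY hf0 * a) := by
  rw [ev_x_eq hf0, ← map_smul, ev_y_yEquiv hf0 hn, smul_eq_mul]

/-- The matrix of the bilinear form `(a, b) ↦ topCoeff (a b)` in the basis of powers of `X`. -/
def hankel (hf0 : f 0 ≠ 0) (hn : 0 < n) : Matrix (Fin n) (Fin n) K :=
  Matrix.of fun i j => topCoeff hf0 hn (lfBasis hf0 i * lfBasis hf0 j)

theorem matDisc_hankel (hf0 : f 0 ≠ 0) (hn : 0 < n) : matDisc (hankel hf0 hn) = (f 0)⁻¹ ^ n := by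
  rw [matDisc, det_antitriangular _ (f 0)⁻¹, ← mul_assoc, ← mul_pow]
  · simp
  · intro i j hij
    rw [hankel, Matrix.of_apply, lfBasis_apply, lfBasis_apply, ← pow_add,
      topCoeff_pow _ _ _ (by omega), if_neg (by omega)]
  · intro i j hij
    rw [hankel, Matrix.of_apply, lfBasis_apply, lfBasis_apply, ← pow_add,
      topCoeff_pow _ _ _ (by omega), if_pos (by omega)]

theorem hankel_mul_leftMulMatrix (hf0 : f 0 ≠ 0) (hn : 0 < n) (a : Lf f) (i j : Fin n) :
    (hankel hf0 hn * Algebra.leftMulMatrix (lfBasis hf0) a) i j =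
      topCoeff hf0 hn (lfBasis hf0 i * (a * lfBasis hf0 j)) := by
  conv_rhs => rw [← (lfBasis hf0).sum_repr (a * lfBasis hf0 j)]
  simp only [Matrix.mul_apply, hankel, Matrix.of_apply, Algebra.leftMulMatrix_eq_repr_mul,
    Finset.mul_sum, map_sum, mul_smul_comm, map_smul, smul_eq_mul]
  exact Finset.sum_congr rfl fun k _ => mul_comm _ _

theorem det_hankel_ne_zero (hf0 : f 0 ≠ 0) (hn : 0 < n) : (hankel hf0 hn).det ≠ 0 := by
  intro h
  have h1 := matDisc_hankel hf0 hn
  rw [matDisc, h, mul_zero] at h1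
  exact pow_ne_zero n (inv_ne_zero hf0) h1.symm

/-- Nondegeneracy of the form `topCoeff (a b)`: its matrix is invertible and `L_f` acts faithfully
on itself. -/
theorem eq_zero_of_topCoeff (hf0 : f 0 ≠ 0) (hn : 0 < n) {a : Lf f}
    (h : ∀ b, topCoeff hf0 hn (b * a) = 0) : a = 0 := by
  have h1 : hankel hf0 hn * Algebra.leftMulMatrix (lfBasis hf0) a = 0 := by
    ext i j
    rw [hankel_mul_leftMulMatrix, mul_left_comm, mul_comm, h]
    rfl
  have h2 := congrArg ((hankel hf0 hn)⁻¹ * ·) h1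
  rw [Matrix.nonsing_inv_mul_cancel_left _ _ (isUnit_iff_ne_zero.2 (det_hankel_ne_zero hf0 hn)),
    Matrix.mul_zero] at h2
  exact (map_eq_zero_iff _ (Algebra.leftMulMatrix_injective (lfBasis hf0))).1 h2

/-- By nondegeneracy `L_f` embeds into its dual, which has the same dimension. -/
theorem exists_topCoeff_eq (hf0 : f 0 ≠ 0) (hn : 0 < n) (l : Lf f →ₗ[K] K) :
    ∃ a, ∀ b, l b = topCoeff hf0 hn (b * a) := by
  have : Module.Finite K (Lf f) := Module.Finite.of_basis (lfBasis hf0)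
  let g : Lf f →ₗ[K] Module.Dual K (Lf f) := (LinearMap.mul K (Lf f)).flip.compr₂ (topCoeff hf0 hn)
  have hg : Function.Injective g := by
    rw [injective_iff_map_eq_zero]
    intro a ha
    refine eq_zero_of_topCoeff hf0 hn fun b => ?_
    exact congrArg (fun l => l b) ha
  obtain ⟨a, ha⟩ := (LinearMap.injective_iff_surjective_of_finrank_eq_finrank
    (Subspace.dual_finrank_eq (K := K) (V := Lf f)).symm).1 hg l
  exact ⟨a, fun b => (congrArg (fun l => l b) ha).symm⟩

theorem isUnit_of_norm_ne_zero (hf0 : f 0 ≠ 0) {a : Lf f} (h : Algebra.norm K a ≠ 0) :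
    IsUnit a := by
  have : Module.Finite K (Lf f) := Module.Finite.of_basis (lfBasis hf0)
  rw [Algebra.norm_apply] at h
  have h1 := LinearMap.range_eq_top.2 (LinearMap.equivOfDetNeZero _ h).surjective
  obtain ⟨b, hb⟩ := LinearMap.range_eq_top.1 h1 1
  exact IsUnit.of_mul_eq_one b hb

end Algebra

theorem φ_smul_smul {K : Type u} [Field K] {n : ℕ} {f : Fin (n + 1) → K} {M : Type u}
    [AddCommGroup M] [Module (Lf f) M] (φ : M ⊗[Lf f] M ≃ₗ[Lf f] If f) (a b : Lf f) (x y : M) :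
    φ ((a • x) ⊗ₜ[Lf f] (b • y)) = (a * b) • φ (x ⊗ₜ[Lf f] y) := by
  rw [TensorProduct.smul_tmul_smul, map_smul]

/-! ### Gram matrices of `f`-modules. -/

section Gram

variable {K : Type u} [Field K] {n : ℕ} {f : Fin (n + 1) → K}
  {M : Type u} [AddCommGroup M] [Module (Lf f) M] [Module K M] [IsScalarTower K (Lf f) M]

/-- The bilinear form `ev_a ∘ φ`. -/
def evForm (hf0 : f 0 ≠ 0) (φ : M ⊗[Lf f] M ≃ₗ[Lf f] If f) (r s : K) : LinearMap.BilinForm K M :=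
  LinearMap.mk₂ K (fun a b => ev f r s (φ (a ⊗ₜ[Lf f] b)))
    (fun a a' b => by rw [TensorProduct.add_tmul, map_add, ev_add hf0])
    (fun c a b => by
      rw [← algebraMap_smul (Lf f) c a, ← TensorProduct.smul_tmul', map_smul, ev_smul hf0,
        smul_eq_mul])
    (fun a b b' => by rw [TensorProduct.tmul_add, map_add, ev_add hf0])
    (fun c a b => by
      rw [← algebraMap_smul (Lf f) c b, TensorProduct.tmul_smul, map_smul, ev_smul hf0,
        smul_eq_mul])

theorem gram_eq_toMatrix (hf0 : f 0 ≠ 0) (φ : M ⊗[Lf f] M ≃ₗ[Lf f] If f)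
    (b : Module.Basis (Fin n) K M) (r s : K) :
    gram f φ b r s = LinearMap.BilinForm.toMatrix b (evForm hf0 φ r s) := by
  ext i j
  rw [LinearMap.BilinForm.toMatrix_apply]
  rfl

theorem gram_congr (hf0 : f 0 ≠ 0) (φ : M ⊗[Lf f] M ≃ₗ[Lf f] If f)
    (b c : Module.Basis (Fin n) K M) (r s : K) :
    gram f φ b r s = (c.toMatrix b)ᵀ * gram f φ c r s * c.toMatrix b := by
  rw [gram_eq_toMatrix hf0, gram_eq_toMatrix hf0, LinearMap.BilinForm.toMatrix_mul_basis_toMatrix]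

theorem gram_ext (hf0 : f 0 ≠ 0) {M' : Type u} [AddCommGroup M'] [Module (Lf f) M'] [Module K M']
    [IsScalarTower K (Lf f) M'] (φ : M ⊗[Lf f] M ≃ₗ[Lf f] If f)
    (φ' : M' ⊗[Lf f] M' ≃ₗ[Lf f] If f) (b : Module.Basis (Fin n) K M)
    (b' : Module.Basis (Fin n) K M') (r s : K) (h : gram f φ b r s = gram f φ' b' r s) (x y : M) :
    ev f r s (φ' (b.equiv b' (Equiv.refl _) x ⊗ₜ[Lf f] b.equiv b' (Equiv.refl _) y)) =
      ev f r s (φ (x ⊗ₜ[Lf f] y)) := by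
  have h1 : (evForm hf0 φ' r s).compl₁₂ (b.equiv b' (Equiv.refl _)).toLinearMap
      (b.equiv b' (Equiv.refl _)).toLinearMap = evForm hf0 φ r s := by
    refine LinearMap.BilinForm.ext_basis b fun i j => ?_
    have := congrFun (congrFun h i) j
    simp only [LinearMap.compl₁₂_apply, LinearEquiv.coe_coe, Module.Basis.equiv_apply]
    exact this.symm
  exact congrArg (fun B => B x y) h1

/-- The basis `u, X u, …, X^{n-1} u`. -/
def genBasis (hf0 : f 0 ≠ 0) (u : Lf f ≃ₗ[Lf f] M) : Module.Basis (Fin n) K M :=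
  (lfBasis hf0).map (u.restrictScalars K)

theorem genBasis_apply (hf0 : f 0 ≠ 0) (u : Lf f ≃ₗ[Lf f] M) (i : Fin n) :
    genBasis hf0 u i = lfBasis hf0 i • u 1 := by
  rw [← map_smul, smul_eq_mul, mul_one]
  rfl

theorem gram_genBasis (hf0 : f 0 ≠ 0) (hn : 2 ≤ n) (φ : M ⊗[Lf f] M ≃ₗ[Lf f] If f)
    (u : Lf f ≃ₗ[Lf f] M) (α : Lf f) (hα : φ (u 1 ⊗ₜ[Lf f] u 1) = yEquiv hf0 _ α) :
    gram f φ (genBasis hf0 u) 0 1 =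
        hankel hf0 (by omega) * Algebra.leftMulMatrix (lfBasis hf0) α ∧
      gram f φ (genBasis hf0 u) 1 0 =
        hankel hf0 (by omega) * Algebra.leftMulMatrix (lfBasis hf0) α *
          Algebra.leftMulMatrix (lfBasis hf0) (xOverY hf0) := by
  constructor
  · ext i j
    rw [hankel_mul_leftMulMatrix, gram, Matrix.of_apply, genBasis_apply, genBasis_apply,
      φ_smul_smul, hα, ← map_smul, ev_y_yEquiv hf0 hn, smul_eq_mul]
    congr 1
    ring
  · rw [Matrix.mul_assoc, ← map_mul]
    ext i j
    rw [hankel_mul_leftMulMatrix, gram, Matrix.of_apply, genBasis_apply, genBasis_apply,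
      φ_smul_smul, hα, ← map_smul, ev_x_yEquiv hf0 hn, smul_eq_mul]
    congr 1
    ring

/-- The exponent `n + 1` arises from the factor `f_0^{-n}` of `matDisc_hankel` and one more `f_0⁻¹`
from normalising the characteristic polynomial of `X`. -/
theorem invariantForm_gram [CharZero K] (hf0 : f 0 ≠ 0) (hn : 2 ≤ n)
    (φ : M ⊗[Lf f] M ≃ₗ[Lf f] If f) (u : Lf f ≃ₗ[Lf f] M) (α : Lf f)
    (hα : φ (u 1 ⊗ₜ[Lf f] u 1) = yEquiv hf0 _ α) (b : Module.Basis (Fin n) K M) :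
    invariantForm (gram f φ b 0 1) (gram f φ b 1 0) =
      MvPolynomial.C (((genBasis hf0 u).det b) ^ 2 * Algebra.norm K α / f 0 ^ (n + 1)) *
        formPoly f := by
  obtain ⟨h1, h2⟩ := gram_genBasis hf0 hn φ u α hα
  rw [gram_congr hf0 φ b (genBasis hf0 u), gram_congr hf0 φ b (genBasis hf0 u) 1 0,
    invariantForm_congr, h1, h2,
    invariantForm_mul hf0 _ _ (charpoly_leftMulMatrix_xOverY hf0), matDisc_mul, matDisc_hankel,
    ← Algebra.norm_eq_matrix_det, ← mul_assoc, ← map_mul, Module.Basis.det_apply]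
  congr 2
  rw [inv_pow]
  field_simp
  ring

theorem invariantForm_gram_eq_iff [CharZero K] (hf0 : f 0 ≠ 0) (hn : 2 ≤ n)
    (φ : M ⊗[Lf f] M ≃ₗ[Lf f] If f) (u : Lf f ≃ₗ[Lf f] M) (α : Lf f)
    (hα : φ (u 1 ⊗ₜ[Lf f] u 1) = yEquiv hf0 _ α) (b : Module.Basis (Fin n) K M) :
    invariantForm (gram f φ b 0 1) (gram f φ b 1 0) = formPoly f ↔
      ((genBasis hf0 u).det b) ^ 2 * Algebra.norm K α = f 0 ^ (n + 1) := by
  rw [invariantForm_gram hf0 hn φ u α hα b, mul_eq_right₀ (formPoly_ne_zero hf0),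
    ← MvPolynomial.C_1, (MvPolynomial.C_injective _ _).eq_iff,
    div_eq_one_iff_eq (pow_ne_zero _ hf0)]

theorem wedgeMap_powerWedge (hf0 : f 0 ≠ 0) (u : Lf f ≃ₗ[Lf f] M) :
    wedgeMap f u.toLinearMap (powerWedge hf0) = exteriorPower.ιMulti K n (genBasis hf0 u) := by
  rw [powerWedge_eq, wedgeMap, exteriorPower.map_apply_ιMulti]
  rfl

theorem wedgeMap_symm_eq_iff {M' : Type u} [AddCommGroup M'] [Module (Lf f) M'] [Module K M']
    [IsScalarTower K (Lf f) M'] (u : M' ≃ₗ[Lf f] M) (e : ⋀[K]^n M) (e' : ⋀[K]^n M') :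
    wedgeMap f u.symm.toLinearMap e = e' ↔ e = wedgeMap f u.toLinearMap e' := by
  have hid : ∀ (N : Type u) [AddCommGroup N] [Module (Lf f) N] [Module K N]
    [IsScalarTower K (Lf f) N] (e : ⋀[K]^n N), wedgeMap f LinearMap.id e = e := fun N _ _ _ _ e =>
      DFunLike.congr_fun (exteriorPower.map_id (R := K) (M := N) (n := n)) e
  constructor
  · rintro rfl
    rw [wedgeMap_wedgeMap, LinearEquiv.comp_symm, hid]
  · rintro rfl
    rw [wedgeMap_wedgeMap, LinearEquiv.symm_comp, hid]

theorem wedge_eq_iff (hf0 : f 0 ≠ 0) (u : Lf f ≃ₗ[Lf f] M) (e : ⋀[K]^n M) (z : K) :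
    wedgeMap f u.symm.toLinearMap e = z • powerWedge hf0 ↔
      e = z • exteriorPower.ιMulti K n (genBasis hf0 u) := by
  rw [wedgeMap_symm_eq_iff, ← wedgeMap_powerWedge, map_smul]

/-- Multiplication by a unit. -/
def unitMul (β : (Lf f)ˣ) : Lf f ≃ₗ[Lf f] Lf f := LinearEquiv.smulOfUnit β

theorem unitMul_apply (β : (Lf f)ˣ) (a : Lf f) : unitMul β a = β * a := rfl

/-- Multiplication by `β` acts on the top exterior power by its determinant `N(β)`; this is why `z`
changes by `N(β)⁻¹`. -/
theorem ιMulti_genBasis_unitMul (hf0 : f 0 ≠ 0) (u : Lf f ≃ₗ[Lf f] M) (β : (Lf f)ˣ) :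
    exteriorPower.ιMulti K n (genBasis hf0 ((unitMul β).trans u)) =
      Algebra.norm K (β : Lf f) • exteriorPower.ιMulti K n (genBasis hf0 u) := by
  have h : wedgeMap f (unitMul β).toLinearMap (powerWedge hf0) =
      Algebra.norm K (β : Lf f) • powerWedge hf0 := by
    rw [powerWedge_eq]
    exact ιMulti_comp_linearMap _ _
  rw [← wedgeMap_powerWedge, ← wedgeMap_powerWedge, ← map_smul, ← h, wedgeMap_wedgeMap]
  rfl

end Gram

/-! ### `f`-modules and pairs `(α, z)`. -/

section Pairs

variable {K : Type u} [Field K] {n : ℕ} {f : Fin (n + 1) → K}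

theorem FModule.exists_generator (hf0 : f 0 ≠ 0) (hn : 0 < n) (S : FModule f) :
    Nonempty (Lf f ≃ₗ[Lf f] S.M) := by
  have := S.free
  have := nontrivial_Lf hf0 hn
  have : Module.Finite (Lf f) S.M := Module.finite_of_finrank_eq_succ S.finrank_eq
  exact ⟨LinearEquiv.ofFinrankEq _ _ ((Module.finrank_self _).trans S.finrank_eq.symm)⟩

theorem hasPair_iff (hf0 : f 0 ≠ 0) (S : FModule f) (p : NormPair f) :
    S.HasPair hf0 p ↔ ∃ u : Lf f ≃ₗ[Lf f] S.M,
      S.φ (u 1 ⊗ₜ[Lf f] u 1) = yEquiv hf0 _ (p.1.1 : Lf f) ∧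
      S.e = (p.1.2 : K) • exteriorPower.ιMulti K n (genBasis hf0 u) := by
  refine exists_congr fun u => ?_
  rw [wedge_eq_iff hf0]
  rfl

theorem FModule.exists_hasPair [CharZero K] (hf0 : f 0 ≠ 0) (hn : 2 ≤ n) (S : FModule f) :
    ∃ p, S.HasPair hf0 p := by
  obtain ⟨u⟩ := S.exists_generator hf0 (by omega)
  obtain ⟨α, hα⟩ := (yEquiv hf0 _).surjective (S.φ (u 1 ⊗ₜ[Lf f] u 1))
  obtain ⟨z, hz⟩ := exists_eq_smul_ιMulti (genBasis hf0 u) S.e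
  have hz0 : z ≠ 0 := by
    rintro rfl
    exact S.e_ne_zero (hz.trans (zero_smul _ _))
  -- The discriminant condition speaks of bases with wedge `e`. Any one of them has determinant `z`
  -- over the powers-of-`X` basis and so yields the norm equation.
  obtain ⟨b, hb⟩ := exists_basis_ιMulti_eq (by omega) (genBasis hf0 u) S.e_ne_zero
  have hd : (genBasis hf0 u).det b = z := by
    rw [ιMulti_eq_det_smul (genBasis hf0 u) b, hz] at hb
    exact smul_left_injective K (ιMulti_basis_ne_zero (genBasis hf0 u)) hb
  have hnorm := (invariantForm_gram_eq_iff hf0 hn S.φ u α hα.symm b).1 (S.disc_eq b hb)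
  rw [hd] at hnorm
  have hα0 : Algebra.norm K α ≠ 0 := by
    intro h
    rw [h, mul_zero] at hnorm
    exact pow_ne_zero _ hf0 hnorm.symm
  have hu := isUnit_of_norm_ne_zero hf0 hα0
  refine ⟨⟨(hu.unit, Units.mk0 z hz0), hnorm⟩, (hasPair_iff hf0 _ _).2 ⟨u, hα.symm, hz⟩⟩

/-- The form `α a b y^{n-3}` on `L_f`. -/
def stdForm (hf0 : f 0 ≠ 0) (α : (Lf f)ˣ) : Lf f ⊗[Lf f] Lf f ≃ₗ[Lf f] If f :=
  ((TensorProduct.lid (Lf f) (Lf f)).trans (unitMul α)).trans (yEquiv hf0 _)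

theorem stdForm_one (hf0 : f 0 ≠ 0) (α : (Lf f)ˣ) :
    stdForm hf0 α (1 ⊗ₜ[Lf f] 1) = yEquiv hf0 _ (α : Lf f) := by
  change yEquiv hf0 _ ((α : Lf f) * ((1 : Lf f) * 1)) = _
  rw [mul_one, mul_one]

/-- The `f`-module `L_f` with the form `α a b y^{n-3}`. -/
def stdFModule [CharZero K] (hf0 : f 0 ≠ 0) (hn : 2 ≤ n) (p : NormPair f) : FModule f where
  M := Lf f
  free := inferInstance
  finrank_eq := by
    have := nontrivial_Lf hf0 (by omega : 0 < n)
    exact Module.finrank_self _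
  φ := stdForm hf0 p.1.1
  e := (p.1.2 : K) • powerWedge hf0
  e_ne_zero := by
    rw [powerWedge_eq]
    exact smul_ne_zero p.1.2.ne_zero (ιMulti_basis_ne_zero _)
  disc_eq b hb := by
    rw [invariantForm_gram_eq_iff hf0 hn _ (LinearEquiv.refl _ _) p.1.1 _ b]
    · have : (genBasis hf0 (LinearEquiv.refl _ (Lf f))).det b = p.1.2 := by
        rw [ιMulti_eq_det_smul (lfBasis hf0) b, powerWedge_eq] at hb
        exact smul_left_injective K (ιMulti_basis_ne_zero (lfBasis hf0)) hb
      rw [this]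
      exact p.2
    · exact stdForm_one hf0 p.1.1

theorem stdFModule_hasPair [CharZero K] (hf0 : f 0 ≠ 0) (hn : 2 ≤ n) (p : NormPair f) :
    (stdFModule hf0 hn p).HasPair hf0 p := by
  rw [hasPair_iff]
  refine ⟨LinearEquiv.refl _ _, ?_, ?_⟩
  · exact stdForm_one hf0 p.1.1
  · change (p.1.2 : K) • powerWedge hf0 = _
    rw [powerWedge_eq]
    rfl

theorem hasPair_of_isomorphic (hf0 : f 0 ≠ 0) {S S' : FModule f} {p : NormPair f}
    (h : S.HasPair hf0 p) (hS : S.Isomorphic S') : S'.HasPair hf0 p := by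
  rw [hasPair_iff] at *
  obtain ⟨u, h1, h2⟩ := h
  obtain ⟨g, hg, hg'⟩ := hS
  refine ⟨u.trans g, (hg _ _).trans h1, ?_⟩
  rw [← hg', h2, map_smul, ← wedgeMap_powerWedge, ← wedgeMap_powerWedge, wedgeMap_wedgeMap]
  rfl

/-- The isomorphism sends one generator to the other; `α` determines `φ` and `z` determines `e`. -/
theorem isomorphic_of_hasPair (hf0 : f 0 ≠ 0) {S S' : FModule f} {p : NormPair f}
    (h : S.HasPair hf0 p) (h' : S'.HasPair hf0 p) : S.Isomorphic S' := by
  rw [hasPair_iff] at *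
  obtain ⟨u, h1, h2⟩ := h
  obtain ⟨u', h1', h2'⟩ := h'
  refine ⟨u.symm.trans u', fun a b => ?_, ?_⟩
  · obtain ⟨a, rfl⟩ := u.surjective a
    obtain ⟨b, rfl⟩ := u.surjective b
    rw [LinearEquiv.trans_apply, LinearEquiv.trans_apply, u.symm_apply_apply, u.symm_apply_apply]
    have e : ∀ {N : Type u} [AddCommGroup N] [Module (Lf f) N] (v : Lf f ≃ₗ[Lf f] N) (c : Lf f),
      v c = c • v 1 := fun v c => by rw [← map_smul, smul_eq_mul, mul_one]
    rw [e u' a, e u' b, e u a, e u b, φ_smul_smul, φ_smul_smul, h1, h1']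
  · rw [h2, h2', map_smul, ← wedgeMap_powerWedge, ← wedgeMap_powerWedge, wedgeMap_wedgeMap]
    have : (u.symm.trans u').toLinearMap ∘ₗ u.toLinearMap = u'.toLinearMap :=
      LinearMap.ext fun a => congrArg u' (u.symm_apply_apply a)
    rw [this]

theorem hasPair_iff_of_hasPair (hf0 : f 0 ≠ 0) {S : FModule f} {p p' : NormPair f}
    (h : S.HasPair hf0 p) : S.HasPair hf0 p' ↔ NormPair.setoid f p p' := by
  rw [hasPair_iff] at *
  obtain ⟨u, h1, h2⟩ := h
  have key : ∀ β : (Lf f)ˣ, S.φ ((unitMul β).trans u 1 ⊗ₜ[Lf f] (unitMul β).trans u 1) =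
      yEquiv hf0 _ ((β : Lf f) ^ 2 * p.1.1) := by
    intro β
    have : (unitMul β).trans u 1 = (β : Lf f) • u 1 := by
      rw [← map_smul]; rfl
    rw [this, φ_smul_smul, h1, ← map_smul, smul_eq_mul, sq]
  constructor
  · rintro ⟨u', h1', h2'⟩
    -- Two generators differ by the unit `β = u⁻¹(u'(1))`.
    let g := u'.trans u.symm
    have hβ : IsUnit (g 1) := by
      refine IsUnit.of_mul_eq_one (g.symm 1) ?_
      rw [mul_comm, ← smul_eq_mul, ← map_smul, smul_eq_mul, mul_one, g.apply_symm_apply]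
    have hu' : (unitMul hβ.unit).trans u = u' := by
      ext a
      rw [LinearEquiv.trans_apply, unitMul_apply, IsUnit.unit_spec, mul_comm, ← smul_eq_mul,
        ← map_smul, smul_eq_mul, mul_one]
      simp [g]
    generalize hβ.unit = β at hu'
    subst hu'
    rw [key] at h1'
    rw [h2, ιMulti_genBasis_unitMul, smul_smul] at h2'
    have h3 := smul_left_injective K (ιMulti_basis_ne_zero (genBasis hf0 u)) h2'
    refine ⟨β, ?_, ?_⟩
    · ext1
      exact ((yEquiv hf0 _).injective h1').symm
    · rw [eq_inv_mul_iff_mul_eq]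
      ext1
      rw [h3, mul_comm]
      rfl
  · rintro ⟨β, h1', h2'⟩
    refine ⟨(unitMul β).trans u, ?_, ?_⟩
    · rw [key, h1']
      rfl
    · rw [ιMulti_genBasis_unitMul, h2, smul_smul]
      congr 1
      rw [eq_inv_mul_iff_mul_eq] at h2'
      rw [← h2', mul_comm]
      rfl

end Pairs

/-! ### Separability and cyclic vectors. -/

section Cyclic

variable {K : Type u} [Field K] {n : ℕ}

theorem separable_dehomY {f : Fin (n + 1) → K} (hΔ : DiscrNeZero f) (hf0 : f 0 ≠ 0) :
    (dehomY f).Separable := by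
  obtain ⟨α, β, h, hd⟩ := hΔ
  have hdeg : (dehomY f).map (algebraMap K (AlgebraicClosure K)) =
      ∏ i, (Polynomial.C (α i) * Polynomial.X - Polynomial.C (β i)) := by
    have := congrArg (MvPolynomial.aeval ![Polynomial.X, (1 : (AlgebraicClosure K)[X])]) h
    simpa [formPoly, dehomY, Polynomial.map_sum, MvPolynomial.algebraMap_eq,
      Polynomial.algebraMap_eq] using this
  have hα : ∀ i, α i ≠ 0 := by
    have := congrArg (MvPolynomial.eval ![(1 : AlgebraicClosure K), 0]) h
    rw [MvPolynomial.eval_map, MvPolynomial.eval₂_eq_eval_map] at this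
    have h2 : ∏ i, α i = algebraMap K _ (f 0) := by
      have h3 : MvPolynomial.map (algebraMap K (AlgebraicClosure K)) (formPoly f) =
          formPoly (fun i => algebraMap K (AlgebraicClosure K) (f i)) := by
        simp [formPoly]
      rw [h3, eval_formPoly_of_eq_zero _ _ (by simp)] at this
      simpa using this.symm
    have h3 : ∏ i, α i ≠ 0 := by
      rw [h2]
      simpa using hf0
    exact fun i => Finset.prod_ne_zero_iff.1 h3 i (Finset.mem_univ i)
  have hd' : ∀ i j, i < j → α i * β j - α j * β i ≠ 0 := by
    intro i j hij h0
    refine hd (Finset.prod_eq_zero (Finset.mem_univ i)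
      (Finset.prod_eq_zero (Finset.mem_Ioi.2 hij) ?_))
    rw [h0]
    simp
  have hd'' : ∀ i j, i ≠ j → α i * β j - α j * β i ≠ 0 := by
    intro i j hij
    rcases lt_or_gt_of_ne hij with h1 | h1
    · exact hd' i j h1
    · rw [← neg_sub]
      exact neg_ne_zero.2 (hd' j i h1)
  rw [← Polynomial.separable_map (algebraMap K (AlgebraicClosure K)), hdeg]
  refine Polynomial.separable_prod (fun i j hij => ?_) fun i => ?_
  -- Bézout coefficients from `α_j(α_i X - β_i) - α_i(α_j X - β_j) = α_i β_j - α_j β_i`.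
  · refine ⟨-Polynomial.C (α j * (α i * β j - α j * β i)⁻¹) * -1,
      -Polynomial.C (α i * (α i * β j - α j * β i)⁻¹), ?_⟩
    have : Polynomial.C (α i * β j - α j * β i) * Polynomial.C (α i * β j - α j * β i)⁻¹ = 1 := by
      rw [← Polynomial.C_mul, mul_inv_cancel₀ (hd'' i j hij), Polynomial.C_1]
    simp only [Polynomial.C_mul, Polynomial.C_sub] at this ⊢
    linear_combination this
  · refine ⟨0, Polynomial.C (α i)⁻¹, ?_⟩
    simp [← Polynomial.C_mul, hα i]

/-- Over the algebraic closure the characteristic polynomial has `n` distinct roots, and each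
eigenvalue is a root of the minimal polynomial. -/
theorem le_natDegree_minpoly_of_separable (T : Matrix (Fin n) (Fin n) K)
    (h : T.charpoly.Separable) : n ≤ (minpoly K T).natDegree := by
  let c := algebraMap K (AlgebraicClosure K)
  have hsep : (T.charpoly.map c).Separable := h.map
  have hm0 : (minpoly K T).map c ≠ 0 :=
    Polynomial.map_ne_zero (minpoly.ne_zero (Algebra.IsIntegral.isIntegral T))
  have hnd := Polynomial.nodup_roots hsep
  have hcard : Multiset.card (T.charpoly.map c).roots = n := by
    rw [← (IsAlgClosed.splits (T.charpoly.map c)).natDegree_eq_card_roots,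
      Polynomial.natDegree_map, Matrix.charpoly_natDegree_eq_dim, Fintype.card_fin]
  have hle : (T.charpoly.map c).roots ≤ ((minpoly K T).map c).roots := by
    rw [Multiset.le_iff_subset hnd]
    intro μ hμ
    rw [Polynomial.mem_roots hm0, Polynomial.IsRoot.def]
    have hμ' : μ ∈ spectrum (AlgebraicClosure K) (T.map c) := by
      rw [Matrix.mem_spectrum_iff_isRoot_charpoly, Matrix.charpoly_map]
      exact Polynomial.isRoot_of_mem_roots hμ
    have h1 : Polynomial.aeval (T.map c) ((minpoly K T).map c) = 0 := by
      have h2 := congrArg (c.mapMatrix) (minpoly.aeval K T)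
      rw [map_zero] at h2
      rw [← h2, Polynomial.aeval_def, Polynomial.aeval_def, Polynomial.eval₂_map,
        Polynomial.hom_eval₂]
      congr 1
      ext a i j
      simp [Matrix.algebraMap_matrix_apply, apply_ite c]
    -- Spectral mapping: the value at `μ` of the minimal polynomial lies in the spectrum of the zero
    -- matrix.
    have h3 := spectrum.subset_polynomial_aeval (T.map c) ((minpoly K T).map c) ⟨μ, hμ', rfl⟩
    rw [h1] at h3
    by_contra h4
    refine h3 ?_
    rw [spectrum.mem_resolventSet_iff, sub_zero]
    exact (IsUnit.mk0 _ h4).map (algebraMap _ _)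
  calc n = Multiset.card (T.charpoly.map c).roots := hcard.symm
    _ ≤ _ := Multiset.card_le_card hle
    _ ≤ _ := Polynomial.card_roots' _
    _ = _ := Polynomial.natDegree_map _

/-- A matrix with separable characteristic polynomial has a cyclic vector. -/
theorem exists_cyclic_vector (T : Matrix (Fin n) (Fin n) K) (h : T.charpoly.Separable) :
    ∃ v : Fin n → K, LinearIndependent K fun i : Fin n => (T ^ (i : ℕ)) *ᵥ v := by
  obtain ⟨g, hg⟩ : ∃ g : Module.End K (Fin n → K), g = Matrix.toLinAlgEquiv' T := ⟨_, rfl⟩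
  -- In `Kⁿ`, viewed as a `K[X]`-module through `T`, some vector has the same annihilator as the
  -- whole module, namely the ideal of the minimal polynomial.
  obtain ⟨x, hx⟩ := Module.exists_ker_toSpanSingleton_eq_annihilator K[X] (Module.AEval' g)
  obtain ⟨v, rfl⟩ := (Module.AEval'.of g).surjective x
  rw [← Polynomial.span_minpoly_eq_annihilator] at hx
  refine ⟨v, ?_⟩
  have hinj : ∀ p : K[X], p.natDegree < n → Polynomial.aeval g p v = 0 → p = 0 := by
    intro p hp hpv
    by_contra hp0
    have h1 : p ∈ Ideal.span {minpoly K g} := by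
      rw [← hx, LinearMap.mem_ker, LinearMap.toSpanSingleton_apply]
      refine (Module.AEval.of_aeval_smul (a := g) p v).symm.trans ?_
      rw [Module.End.smul_def, hpv, map_zero]
    rw [Ideal.mem_span_singleton] at h1
    have h2 := Polynomial.natDegree_le_of_dvd h1 hp0
    rw [hg, minpoly.algEquiv_eq] at h2
    have := le_natDegree_minpoly_of_separable T h
    omega
  rw [Fintype.linearIndependent_iff]
  intro a ha i
  have h1 := hinj (∑ i : Fin n, Polynomial.C (a i) * Polynomial.X ^ (i : ℕ)) ?_ ?_
  · have h2 := congrArg (fun p => Polynomial.coeff p i) h1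
    simpa [Polynomial.finsetSum_coeff, Polynomial.coeff_C_mul, Polynomial.coeff_X_pow,
      Fin.val_inj] using h2
  · have hn : 0 < n := i.pos
    refine lt_of_le_of_lt (Polynomial.natDegree_sum_le_of_forall_le (n := n - 1) _ _ fun i _ => ?_)
      (by omega)
    exact (Polynomial.natDegree_C_mul_X_pow_le _ _).trans (by omega)
  · rw [map_sum, LinearMap.sum_apply, ← ha]
    refine Finset.sum_congr rfl fun i _ => ?_
    have h3 : g ^ (i : ℕ) = Matrix.toLinAlgEquiv' (T ^ (i : ℕ)) := by rw [hg, map_pow]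
    rw [map_mul, map_pow, Polynomial.aeval_X, Polynomial.aeval_C, h3]
    rfl

end Cyclic

/-! ### `f`-modules and orbits of pairs of matrices. -/

section Matrices

variable {K : Type u} [Field K] {n : ℕ} {f : Fin (n + 1) → K}

theorem exists_basis_toMatrix_eq {M : Type*} [AddCommGroup M] [Module K M]
    (b : Module.Basis (Fin n) K M) (g : Matrix (Fin n) (Fin n) K) (hg : g.det ≠ 0) :
    ∃ b' : Module.Basis (Fin n) K M, b.toMatrix b' = g := by
  refine ⟨b.map (Matrix.toLinearEquiv b g (isUnit_iff_ne_zero.2 hg)), ?_⟩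
  ext i j
  rw [Module.Basis.toMatrix_apply, Module.Basis.map_apply, Matrix.toLinearEquiv_apply,
    Matrix.toLin_self, Module.Basis.repr_sum_self]

theorem hasMatrices_of_isomorphic {S S' : FModule f} {v : Vf f} (h : S.HasMatrices v)
    (hS : S.Isomorphic S') : S'.HasMatrices v := by
  obtain ⟨b, hb, hA, hB⟩ := h
  obtain ⟨g, hg, hg'⟩ := hS
  have h1 : ∀ r s, gram f S'.φ (b.map (g.restrictScalars K)) r s = gram f S.φ b r s := by
    intro r s
    ext i j
    exact congrArg (ev f r s) (hg _ _)
  refine ⟨b.map (g.restrictScalars K), ?_, by rw [h1, hA], by rw [h1, hB]⟩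
  rw [← hg', ← hb, wedgeMap, exteriorPower.map_apply_ιMulti]
  rfl

theorem Vf.smul_A (g : Matrix.SpecialLinearGroup (Fin n) K) (v : Vf f) :
    (g • v).A = (g⁻¹).1ᵀ * v.A * (g⁻¹).1 := rfl

theorem Vf.smul_B (g : Matrix.SpecialLinearGroup (Fin n) K) (v : Vf f) :
    (g • v).B = (g⁻¹).1ᵀ * v.B * (g⁻¹).1 := rfl

/-- Since `e ≠ 0`, two bases have the same wedge exactly when the transition matrix has determinant
`1`, and Gram matrices change by congruence. -/
theorem hasMatrices_iff_of_hasMatrices (hf0 : f 0 ≠ 0) {S : FModule f} {v v' : Vf f}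
    (h : S.HasMatrices v) : S.HasMatrices v' ↔
      MulAction.orbitRel (Matrix.SpecialLinearGroup (Fin n) K) (Vf f) v v' := by
  obtain ⟨b, hb, hA, hB⟩ := h
  rw [MulAction.orbitRel_apply, MulAction.mem_orbit_iff]
  constructor
  · rintro ⟨b', hb', hA', hB'⟩
    have hd : (b'.toMatrix b).det = 1 := by
      have h1 := ιMulti_eq_det_smul b' b
      rw [hb, hb'] at h1
      rw [← Module.Basis.det_apply]
      refine smul_left_injective K S.e_ne_zero ?_
      dsimp only
      rw [← h1, one_smul]
    obtain ⟨g, hg⟩ : ∃ g : Matrix.SpecialLinearGroup (Fin n) K, g.1 = b'.toMatrix b :=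
      ⟨⟨_, hd⟩, rfl⟩
    refine ⟨g⁻¹, Vf.ext ?_ ?_⟩
    · rw [Vf.smul_A, inv_inv, hA, hA', gram_congr hf0 S.φ b b', hg]
    · rw [Vf.smul_B, inv_inv, hB, hB', gram_congr hf0 S.φ b b', hg]
  · rintro ⟨g, hg⟩
    have hg' : v' = g⁻¹ • v := by rw [← hg, inv_smul_smul]
    obtain ⟨b', hb'⟩ := exists_basis_toMatrix_eq b g.1 (by rw [g.2]; exact one_ne_zero)
    refine ⟨b', ?_, ?_, ?_⟩
    · rw [ιMulti_eq_det_smul b b', Module.Basis.det_apply, hb', g.2, one_smul, hb]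
    · rw [hg', Vf.smul_A, inv_inv, hA, gram_congr hf0 S.φ b' b, hb']
    · rw [hg', Vf.smul_B, inv_inv, hB, gram_congr hf0 S.φ b' b, hb']

theorem FModule.exists_hasMatrices (hf0 : f 0 ≠ 0) (hn : 2 ≤ n) (S : FModule f) :
    ∃ v, S.HasMatrices v := by
  obtain ⟨u⟩ := S.exists_generator hf0 (by omega)
  obtain ⟨b, hb⟩ := exists_basis_ιMulti_eq (by omega) (genBasis hf0 u) S.e_ne_zero
  -- `φ` is automatically symmetric because `M` has rank one.
  have hcomm : ∀ x y : S.M, S.φ (x ⊗ₜ[Lf f] y) = S.φ (y ⊗ₜ[Lf f] x) := by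
    intro x y
    have e : ∀ x, x = u.symm x • u 1 := fun x => by
      rw [← map_smul, smul_eq_mul, mul_one, u.apply_symm_apply]
    rw [e x, e y, φ_smul_smul, φ_smul_smul, mul_comm]
  have hs : ∀ r s, (gram f S.φ b r s).IsSymm := fun r s => by
    ext i j
    exact congrArg (ev f r s) (hcomm _ _)
  exact ⟨⟨_, _, hs 0 1, hs 1 0, S.disc_eq b hb⟩, b, hb, rfl, rfl⟩

theorem eq_of_ev_eq (hf0 : f 0 ≠ 0) (hn : 2 ≤ n) (v w : If f)
    (h : ∀ a : Lf f, ev f 0 1 (a • v) = ev f 0 1 (a • w)) : v = w := by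
  obtain ⟨a, rfl⟩ := (yEquiv hf0 _).surjective v
  obtain ⟨b, rfl⟩ := (yEquiv hf0 _).surjective w
  congr 1
  rw [← sub_eq_zero]
  refine eq_zero_of_topCoeff hf0 (by omega) fun c => ?_
  have h1 := h c
  rw [← map_smul, ← map_smul, ev_y_yEquiv hf0 hn, ev_y_yEquiv hf0 hn] at h1
  rw [mul_sub, map_sub]
  exact sub_eq_zero.2 h1

/-- Testing against all multiples of a generator `u` gives `u ⊗ x = u ⊗ y` by nondegeneracy, and a
generator can be cancelled. -/
theorem FModule.eq_of_tmul_eq (hf0 : f 0 ≠ 0) (hn : 2 ≤ n) (S : FModule f) {x y : S.M}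
    (h : ∀ w, ev f 0 1 (S.φ (w ⊗ₜ[Lf f] x)) = ev f 0 1 (S.φ (w ⊗ₜ[Lf f] y))) : x = y := by
  obtain ⟨u⟩ := S.exists_generator hf0 (by omega)
  have h1 : S.φ (u 1 ⊗ₜ[Lf f] x) = S.φ (u 1 ⊗ₜ[Lf f] y) := by
    refine eq_of_ev_eq hf0 hn _ _ fun a => ?_
    rw [← map_smul, ← map_smul, TensorProduct.smul_tmul', TensorProduct.smul_tmul']
    exact h _
  have h2 := congrArg (TensorProduct.lid (Lf f) (Lf f)) (congrArg
    (TensorProduct.congr u.symm u.symm) (S.φ.injective h1))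
  simpa using h2

theorem isomorphic_of_hasMatrices (hf0 : f 0 ≠ 0) (hn : 2 ≤ n) {S S' : FModule f} {v : Vf f}
    (h : S.HasMatrices v) (h' : S'.HasMatrices v) : S.Isomorphic S' := by
  obtain ⟨b, hb, hA, hB⟩ := h
  obtain ⟨b', hb', hA', hB'⟩ := h'
  have h01 := gram_ext hf0 S.φ S'.φ b b' 0 1 (hA.symm.trans hA')
  have h10 := gram_ext hf0 S.φ S'.φ b b' 1 0 (hB.symm.trans hB')
  have hgb : ∀ i, b.equiv b' (Equiv.refl _) (b i) = b' i := fun i => by simp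
  generalize b.equiv b' (Equiv.refl _) = g at h01 h10 hgb
  -- The `K`-linear map matching the bases preserves both forms. As `ev_x` is `ev_y` after
  -- multiplication by `X`, nondegeneracy forces it to commute with `X`.
  have hX : ∀ x, g (xOverY hf0 • x) = xOverY hf0 • g x := by
    intro x
    refine S'.eq_of_tmul_eq hf0 hn fun w => ?_
    obtain ⟨w, rfl⟩ := g.surjective w
    rw [h01, TensorProduct.tmul_smul, map_smul, ← ev_x_eq hf0, TensorProduct.tmul_smul, map_smul,
      ← ev_x_eq hf0, h10]
  have hXk : ∀ (k : ℕ) x, g (xOverY hf0 ^ k • x) = xOverY hf0 ^ k • g x := by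
    intro k
    induction k with
    | zero => simp
    | succ k ih => intro x; rw [pow_succ', mul_smul, hX, ih, mul_smul]
  have hL : ∀ (a : Lf f) x, g (a • x) = a • g x := by
    intro a x
    rw [← (lfBasis hf0).sum_repr a, Finset.sum_smul, Finset.sum_smul, map_sum]
    refine Finset.sum_congr rfl fun i _ => ?_
    rw [smul_assoc, smul_assoc, map_smul, lfBasis_apply, hXk]
  let G : S.M ≃ₗ[Lf f] S'.M := { g with map_smul' := hL }
  refine ⟨G, fun x y => ?_, ?_⟩
  -- A value of `φ` is recovered from `ev_y` of all its `L_f`-multiples, and a multiplier can be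
  -- moved into the first argument.
  · refine eq_of_ev_eq hf0 hn _ _ fun a => ?_
    rw [← map_smul, ← map_smul, TensorProduct.smul_tmul', TensorProduct.smul_tmul', ← h01, hL]
    rfl
  · rw [← hb, ← hb', wedgeMap, exteriorPower.map_apply_ιMulti]
    congr 1
    ext i
    exact hgb i

theorem exists_hankel_eq [CharZero K] (hΔ : DiscrNeZero f) (hf0 : f 0 ≠ 0) (hn : 0 < n) (v : Vf f) :
    ∃ (α : Lf f) (P : Matrix (Fin n) (Fin n) K), P.det ≠ 0 ∧
      Pᵀ * v.A * P = hankel hf0 hn * Algebra.leftMulMatrix (lfBasis hf0) α ∧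
      Pᵀ * v.B * P = hankel hf0 hn * Algebra.leftMulMatrix (lfBasis hf0) α *
        Algebra.leftMulMatrix (lfBasis hf0) (xOverY hf0) := by
  obtain ⟨A, B, hAs, hBs, hAB⟩ := v
  dsimp only
  have hdet : A.det ≠ 0 := by
    intro h
    have := matDisc_of_invariantForm_eq hAB
    rw [matDisc, h, mul_zero] at this
    exact hf0 this.symm
  obtain ⟨T, rfl⟩ : ∃ T, A * T = B :=
    ⟨A⁻¹ * B, Matrix.mul_nonsing_inv_cancel_left _ _ (isUnit_iff_ne_zero.2 hdet)⟩
  have hchar := charpoly_of_invariantForm_eq hAB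
  have hsep : T.charpoly.Separable := by
    have := separable_dehomY hΔ hf0
    rw [← hchar] at this
    exact this.of_mul_right
  obtain ⟨w, hw⟩ := exists_cyclic_vector T hsep
  have hmin : Polynomial.aeval T (minpoly K (lfPowerBasis hf0).gen) = 0 := by
    have h1 : minpoly K (lfPowerBasis hf0).gen = T.charpoly := by
      refine mul_left_cancel₀ (Polynomial.C_ne_zero.2 hf0) ?_
      rw [lfPowerBasis_gen, hchar, minpoly_xOverY]
    rw [h1, Matrix.aeval_self_charpoly]
  let ρ := (lfPowerBasis hf0).lift T hmin
  have hρX : ρ (xOverY hf0) = T := by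
    rw [← lfPowerBasis_gen hf0]
    exact (lfPowerBasis hf0).lift_gen T hmin
  -- The functional `a ↦ wᵗ A ρ(a) w` is represented by `α`, which becomes the invariant of the
  -- pair.
  let l : Lf f →ₗ[K] K := (dotProductBilin K K w) ∘ₗ (Matrix.mulVecBilin K K).flip w ∘ₗ
    LinearMap.mulLeft K A ∘ₗ ρ.toLinearMap
  have hl : ∀ a, l a = w ⬝ᵥ ((A * ρ a) *ᵥ w) := fun a => rfl
  obtain ⟨α, hα⟩ := exists_topCoeff_eq hf0 hn l
  -- Symmetry of `B = AT` says that `T` is self-adjoint for `A`; so entries of the form in the basis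
  -- `T^i w` depend only on `i + j`.
  have hTA : ∀ k : ℕ, (T ^ k)ᵀ * A = A * T ^ k := by
    intro k
    induction k with
    | zero => simp
    | succ k ih =>
      have h1 : Tᵀ * A = A * T := by
        rw [← hBs, Matrix.transpose_mul, hAs]
      rw [pow_succ', Matrix.transpose_mul, Matrix.mul_assoc, h1, ← Matrix.mul_assoc, ih,
        Matrix.mul_assoc, ← pow_succ, pow_succ']
  let P : Matrix (Fin n) (Fin n) K := Matrix.of fun i j => ((T ^ (j : ℕ)) *ᵥ w) i
  have hP : ∀ (C : Matrix (Fin n) (Fin n) K) (i j : Fin n), (Pᵀ * C * P) i j =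
      ((T ^ (i : ℕ)) *ᵥ w) ⬝ᵥ (C *ᵥ ((T ^ (j : ℕ)) *ᵥ w)) := by
    intro C i j
    rw [Matrix.mul_assoc, Matrix.mul_apply']
    rfl
  have hP' : ∀ (k : ℕ) (i j : Fin n), (Pᵀ * (A * T ^ k) * P) i j =
      topCoeff hf0 hn (lfBasis hf0 i * (α * xOverY hf0 ^ k * lfBasis hf0 j)) := by
    intro k i j
    rw [hP, Matrix.dotProduct_mulVec, ← Matrix.vecMul_transpose, Matrix.vecMul_vecMul,
      ← Matrix.dotProduct_mulVec, Matrix.mulVec_mulVec, ← Matrix.mul_assoc, hTA,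
      Matrix.mul_assoc, Matrix.mul_assoc, ← pow_add, ← pow_add]
    have h1 := hα (xOverY hf0 ^ ((i : ℕ) + (k + j)))
    rw [hl, map_pow, hρX] at h1
    rw [h1, lfBasis_apply, lfBasis_apply]
    congr 1
    ring
  refine ⟨α, P, ?_, ?_, ?_⟩
  · have h1 : LinearIndependent K P.col := hw
    rw [Matrix.linearIndependent_cols_iff_isUnit] at h1
    exact ((Matrix.isUnit_iff_isUnit_det _).1 h1).ne_zero
  · ext i j
    have := hP' 0 i j
    rw [pow_zero, pow_zero, mul_one, mul_one] at this
    rw [this, hankel_mul_leftMulMatrix]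
  · ext i j
    have := hP' 1 i j
    rw [pow_one, pow_one] at this
    rw [this, Matrix.mul_assoc, ← map_mul, hankel_mul_leftMulMatrix]

theorem exists_fModule_hasMatrices [CharZero K] (hΔ : DiscrNeZero f) (hf0 : f 0 ≠ 0) (hn : 2 ≤ n)
    (v : Vf f) : ∃ S : FModule f, S.HasMatrices v := by
  obtain ⟨α, P, hP, hA, hB⟩ := exists_hankel_eq hΔ hf0 (by omega) v
  have hdisc := matDisc_congr P v.A
  rw [hA, matDisc_mul, matDisc_hankel, ← Algebra.norm_eq_matrix_det,
    matDisc_of_invariantForm_eq v.form_eq] at hdisc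
  have hN : Algebra.norm K α ≠ 0 := by
    intro h
    rw [h, mul_zero] at hdisc
    exact mul_ne_zero (pow_ne_zero 2 hP) hf0 hdisc.symm
  have hu := isUnit_of_norm_ne_zero hf0 hN
  -- Taking discriminants of `Pᵗ A P = H m_α` gives `f_0^{-n} N(α) = (det P)² f_0`; thus `z = (det
  -- P)⁻¹` solves the norm equation. It is the determinant of the basis `b` below, which undoes the
  -- congruence by `P`.
  let p : NormPair f := ⟨(hu.unit, (Units.mk0 P.det hP)⁻¹), by
    rw [Units.val_inv_eq_inv_val, Units.val_mk0, IsUnit.unit_spec]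
    rw [inv_pow] at hdisc ⊢
    field_simp at hdisc ⊢
    rw [hdisc]
    ring⟩
  have hP' := isUnit_iff_ne_zero.2 hP
  have hdetinv : (P⁻¹).det = P.det⁻¹ := by
    rw [Matrix.det_nonsing_inv, Ring.inverse_eq_inv']
  obtain ⟨b, hb⟩ := exists_basis_toMatrix_eq (lfBasis hf0) P⁻¹
    (by rw [hdetinv]; exact inv_ne_zero hP)
  obtain ⟨h1, h2⟩ := gram_genBasis hf0 hn (stdForm hf0 hu.unit) (LinearEquiv.refl _ _) α
    (stdForm_one hf0 hu.unit)
  have hcancel : ∀ C : Matrix (Fin n) (Fin n) K, C = (P⁻¹)ᵀ * (Pᵀ * C * P) * P⁻¹ := by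
    intro C
    rw [← Matrix.mul_assoc, ← Matrix.mul_assoc, ← Matrix.transpose_mul,
      Matrix.mul_nonsing_inv _ hP', Matrix.transpose_one, Matrix.one_mul,
      Matrix.mul_nonsing_inv_cancel_right _ _ hP']
  refine ⟨stdFModule hf0 hn p, b, ?_, ?_, ?_⟩
  · change exteriorPower.ιMulti K n b = ((Units.mk0 P.det hP)⁻¹ : Kˣ).val • powerWedge hf0
    rw [ιMulti_eq_det_smul (lfBasis hf0) b, powerWedge_eq, Module.Basis.det_apply, hb, hdetinv,
      Units.val_inv_eq_inv_val, Units.val_mk0]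
  · change v.A = gram f (stdForm hf0 hu.unit) b 0 1
    rw [gram_congr hf0 _ b (genBasis hf0 (LinearEquiv.refl _ _)), h1, ← hA]
    exact (hcancel v.A).trans (by rw [← hb]; rfl)
  · change v.B = gram f (stdForm hf0 hu.unit) b 1 0
    rw [gram_congr hf0 _ b (genBasis hf0 (LinearEquiv.refl _ _)), h2, ← hB]
    exact (hcancel v.B).trans (by rw [← hb]; rfl)

end Matrices

end PencilOrbits

end

/-! ### The two bijections. -/

theorem mainTheorem10 {K : Type u} [Field K] [CharZero K] {n : ℕ} (hn : 2 ≤ n)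
    (f : Fin (n + 1) → K) (hΔ : PencilOrbits.DiscrNeZero f) (hf0 : f 0 ≠ 0) :
    ∃ (Φ : PencilOrbits.FModuleClasses f → PencilOrbits.Orbits f)
      (Ψ : PencilOrbits.FModuleClasses f → PencilOrbits.NormPairClasses f),
      Function.Bijective Φ ∧ Function.Bijective Ψ ∧
      (∀ (S : PencilOrbits.FModule f) (v : PencilOrbits.Vf f),
        Φ (Quotient.mk _ S) = Quotient.mk _ v ↔ S.HasMatrices v) ∧
      (∀ (S : PencilOrbits.FModule f) (p : PencilOrbits.NormPair f),
        Ψ (Quotient.mk _ S) = Quotient.mk _ p ↔ S.HasPair hf0 p) := by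
  obtain ⟨Φ, hΦ, hΦ'⟩ := PencilOrbits.exists_bijective_quotient
    (PencilOrbits.FModule.setoid f)
    (MulAction.orbitRel (Matrix.SpecialLinearGroup (Fin n) K) (PencilOrbits.Vf f))
    PencilOrbits.FModule.HasMatrices
    (PencilOrbits.FModule.exists_hasMatrices hf0 hn)
    (PencilOrbits.exists_fModule_hasMatrices hΔ hf0 hn)
    (fun _ _ _ => PencilOrbits.hasMatrices_of_isomorphic)
    (fun _ _ _ => PencilOrbits.hasMatrices_iff_of_hasMatrices hf0)
    (fun _ _ _ => PencilOrbits.isomorphic_of_hasMatrices hf0 hn)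
  obtain ⟨Ψ, hΨ, hΨ'⟩ := PencilOrbits.exists_bijective_quotient
    (PencilOrbits.FModule.setoid f) (PencilOrbits.NormPair.setoid f)
    (PencilOrbits.FModule.HasPair hf0)
    (PencilOrbits.FModule.exists_hasPair hf0 hn)
    (fun p => ⟨_, PencilOrbits.stdFModule_hasPair hf0 hn p⟩)
    (fun _ _ _ => PencilOrbits.hasPair_of_isomorphic hf0)
    (fun _ _ _ => PencilOrbits.hasPair_iff_of_hasPair hf0)
    (fun _ _ _ => PencilOrbits.isomorphic_of_hasPair hf0)
  exact ⟨Φ, Ψ, hΦ, hΨ, hΦ', hΨ'⟩
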